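/- Let $G$ be a compact connected Lie group with Lie algebra $\mathfrak g$, and let $\cdot$ be an $\mathrm{Ad}$-invariant inner product on $\mathfrak g$. For an integer $g\ge 0$ let $F$ be the free group on $x_1,\dots,x_{2g}$, let $R=\prod_{i=1}^g[x_{2i-1},x_{2i}]$ with $[a,b]=aba^{-1}b^{-1}$, and let $c=\sum_{i=1}^{2g}(\partial R/\partial x_i,x_i)\in\mathbb Z[F\times F]$ be the group $2$-chain formed with the Fox derivatives of $R$. Put $Y=\mathrm{Hom}(F,G)=G^{2g}$ and let $\varepsilon_R:Y\to G$, $\varepsilon_R(y)=\prod_{i=1}^g[y_{2i-1},y_{2i}]$. Let $\Omega=\theta_1\cdot\bar\theta_2\in\Omega^2(G\times G)$, where $\theta_1$ is the pullback of the left-invariant Maurer–Cartan form from the first factor and $\bar\theta_2$ the pullback of the right-invariant one from the second, so that $\Omega(u,v)=\theta_1(u)\cdot\bar\theta_2(v)-\theta_1(v)\cdot\bar\theta_2(u)$. Let $\omega=\langle c,E^*\Omega\rangle$, that is, if $c=\sum_k n_k\,(a_k,b_k)$ then $\omega=\sum_k n_k\,(E_{a_k,b_k})^*\Omega$ with $E_{a,b}:Y\to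 G\times G$, $y\mapsto(y(a),y(b))$. For $t\in G$ let $Y_t=\varepsilon_R^{-1}(t)$, a possibly singular subset of $Y$ with Zariski tangent spaces $T_yY_t=\ker (d\varepsilon_R)_y$, and let the centralizer $Z_t$ of $t$ act on $Y_t$ by simultaneous conjugation. Then for every $t\in G$: 1. $\omega$ is a smooth $2$-form on $Y$ which restricts to a closed form on $Y_t$: for every $y\in Y_t$ the form $(d\omega)_y$ vanishes on $T_yY_t$, and for every smooth map $f$ from an open subset of a Euclidean space into $Y$ with image in $Y_t$, the form $f^*\omega$ is smooth and closed (in particular $\omega$ restricts to a closed form on every submanifold of $Y$ contained in $Y_t$). 2. $\omega$ descends to a unique $2$-form $\bar\omega$ on the relative character variety $M_t=Y_t/Z_t$, and $\bar\omega$ is smooth and closed. Here the tangent space of $M_t$ at the orbit of $y$ is $T_yY_t/\{\tilde\eta(y):\eta\in\mathrm{Lie}(Z_t)\}$, where $\tilde\eta$ is the vector field on $Y$ generated by $\eta$; a $2$-form on $M_t$ is a family of alternating bilinear forms on these spaces that is compatible with the identifications, induced by $z\in Z_t$, between the spaces computed at $y$ and at $z\cdot y$; $\omega$ descends to it if its pullback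 to each $T_yY_t$ is the restriction of $\omega$; and it is smooth and closed if its pullbacks under all smooth maps from open subsets of Euclidean spaces to $Y_t$ are smooth and closed. -/

import Mathlib

open scoped Manifold ContDiff

noncomputable section

/-! ## Differential forms on manifolds -/

section Forms

/-- A (not necessarily smooth) differential `k`-form on a manifold `M`. -/
abbrev DiffForm {E : Type*} [NormedAddCommGroup E] [NormedSpace ℝ E]
    {H : Type*} [TopologicalSpace H] (I : ModelWithCorners ℝ E H)
    (M : Type*) [TopologicalSpace M] [ChartedSpace H M] (k : ℕ) : Type _ :=
  ∀ x : M, TangentSpace I x [⋀^Fin k]→L[ℝ] ℝ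

variable {E : Type*} [NormedAddCommGroup E] [NormedSpace ℝ E]
  {H : Type*} [TopologicalSpace H] {I : ModelWithCorners ℝ E H}
  {M : Type*} [TopologicalSpace M] [ChartedSpace H M]
  {E' : Type*} [NormedAddCommGroup E'] [NormedSpace ℝ E']
  {H' : Type*} [TopologicalSpace H'] {I' : ModelWithCorners ℝ E' H'}
  {N : Type*} [TopologicalSpace N] [ChartedSpace H' N] {k : ℕ}

namespace DiffForm

/-- The pullback `f^* φ`. -/
def pullback (I : ModelWithCorners ℝ E H) (I' : ModelWithCorners ℝ E' H')
    (f : M → N) (φ : DiffForm I' N k) : DiffForm I M k :=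
  fun x => (φ (f x)).compContinuousLinearMap (mfderiv I I' f x)

/-- The expression of a form on `M` in the preferred chart around `x₀`: a form on the model vector
space (meaningful on the target of the chart). -/
def inChart (φ : DiffForm I M k) (x₀ : M) : E → E [⋀^Fin k]→L[ℝ] ℝ :=
  fun p => (φ ((extChartAt I x₀).symm p)).compContinuousLinearMap
    (mfderiv 𝓘(ℝ, E) I (extChartAt I x₀).symm p)

/-- Smoothness of a form on a manifold without boundary. -/
def IsSmooth (φ : DiffForm I M k) : Prop :=
  ∀ x : M, ContDiffAt ℝ ∞ (inChart φ x) (extChartAt I x x)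

/-- The exterior derivative of a form on a manifold without boundary, at `x`: it is computed in
the preferred chart around `x`, whose derivative at `x` is the identity of `TangentSpace I x`. -/
def extDeriv (φ : DiffForm I M k) : DiffForm I M (k + 1) :=
  fun x => (_root_.extDeriv (inChart φ x) (extChartAt I x x) : E [⋀^Fin (k + 1)]→L[ℝ] ℝ)

/-- A smooth map from an open subset `U` of `ℝ^n` to `M` with values in the subset `S`. -/
def IsPlotInto (I : ModelWithCorners ℝ E H) (S : Set M) {n : ℕ}
    (U : Set (EuclideanSpace ℝ (Fin n))) (f : EuclideanSpace ℝ (Fin n) → M) : Prop :=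
  IsOpen U ∧ ContMDiffOn 𝓘(ℝ, EuclideanSpace ℝ (Fin n)) I ∞ f U ∧ Set.MapsTo f U S

/-- A form on (an open subset `U` of) `ℝ^n` is smooth and closed on `U`. -/
def IsSmoothClosedOn {n : ℕ} (γ : EuclideanSpace ℝ (Fin n) →
    EuclideanSpace ℝ (Fin n) [⋀^Fin k]→L[ℝ] ℝ) (U : Set (EuclideanSpace ℝ (Fin n))) : Prop :=
  ContDiffOn ℝ ∞ γ U ∧ ∀ r ∈ U, _root_.extDeriv γ r = 0

/-- The form `φ` restricts to a closed form on the (possibly singular) subset `S`: its pullback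
under every smooth map from an open subset of a Euclidean space into `M` with image in `S` is
a smooth closed form. In particular the restriction of `φ` to every submanifold of `M` that is
contained in `S` is closed. -/
def RestrictsToClosed (φ : DiffForm I M k) (S : Set M) : Prop :=
  ∀ (n : ℕ) (U : Set (EuclideanSpace ℝ (Fin n))) (f : EuclideanSpace ℝ (Fin n) → M),
    IsPlotInto I S U f →
      IsSmoothClosedOn (pullback 𝓘(ℝ, EuclideanSpace ℝ (Fin n)) I f φ) U

end DiffForm

end Forms

/-! ## Free groups, Fox calculus and the distinguished 2-chain -/

section Fox

variable {α : Type*} [DecidableEq α]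

/-- The homomorphism `w ↦ [[w, ∂w/∂x_i], [0, 1]]` from the free group to the invertible matrices
over its integral group ring. -/
def foxMatrix (i : α) : FreeGroup α →* (Matrix (Fin 2) (Fin 2) (MonoidAlgebra ℤ (FreeGroup α)))ˣ :=
  FreeGroup.lift fun j =>
    { val := !![MonoidAlgebra.of ℤ _ (FreeGroup.of j), if j = i then 1 else 0; 0, 1]
      inv := !![MonoidAlgebra.of ℤ _ (FreeGroup.of j)⁻¹,
        if j = i then -MonoidAlgebra.of ℤ _ (FreeGroup.of j)⁻¹ else 0; 0, 1]
      val_inv := by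
        split_ifs <;> simp [Matrix.one_fin_two, MonoidAlgebra.one_def]
      inv_val := by
        split_ifs <;> simp [Matrix.one_fin_two, MonoidAlgebra.one_def] }

/-- The Fox derivative `∂w/∂x_i` in the integral group ring of the free group. -/
def foxDeriv (i : α) (w : FreeGroup α) : MonoidAlgebra ℤ (FreeGroup α) :=
  (foxMatrix i w).val 0 1

theorem foxDeriv_of (i j : α) : foxDeriv i (FreeGroup.of j) = if j = i then 1 else 0 := by
  simp [foxDeriv, foxMatrix]

theorem foxDeriv_mul (i : α) (v w : FreeGroup α) :
    foxDeriv i (v * w) = foxDeriv i v + MonoidAlgebra.of ℤ _ v * foxDeriv i w := by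
  have key : ∀ u : FreeGroup α, (foxMatrix i u).val 0 0 = MonoidAlgebra.of ℤ _ u ∧
      (foxMatrix i u).val 1 1 = 1 := by
    intro u
    have hh : ∀ u : FreeGroup α, (foxMatrix i u).val 0 0 = MonoidAlgebra.of ℤ _ u ∧
        (foxMatrix i u).val 1 0 = 0 ∧ (foxMatrix i u).val 1 1 = 1 := by
      intro u
      induction u using FreeGroup.induction_on with
      | C1 => simp [MonoidAlgebra.one_def]
      | of x => simp [foxMatrix]
      | inv_of x _ => simp [foxMatrix]
      | mul x y hx hy =>
        simp only [map_mul, Units.val_mul, Matrix.mul_apply, Fin.sum_univ_two]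
        simp [hx.1, hx.2.1, hx.2.2, hy.1, hy.2.1, hy.2.2]
    exact ⟨(hh u).1, (hh u).2.2⟩
  simp only [foxDeriv, map_mul, Units.val_mul, Matrix.mul_apply, Fin.sum_univ_two]
  rw [(key v).1, (key w).2, mul_one, add_comm]

end Fox

/-- The index of the generator `x_{2i+1}` (`0 ≤ i < g`), counting the generators from `x_1`. -/
def oddIdx {g : ℕ} (i : Fin g) : Fin (2 * g) := ⟨2 * i, by omega⟩

/-- The index of the generator `x_{2i+2}` (`0 ≤ i < g`), counting the generators from `x_1`. -/
def evenIdx {g : ℕ} (i : Fin g) : Fin (2 * g) := ⟨2 * i + 1, by omega⟩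

/-- The surface relation `R = [x_1, x_2] [x_3, x_4] ⋯ [x_{2g-1}, x_{2g}]` in the free group
on `2g` generators, where `[a, b] = a b a⁻¹ b⁻¹`. -/
def surfaceRel (g : ℕ) : FreeGroup (Fin (2 * g)) :=
  (List.ofFn fun i : Fin g =>
    FreeGroup.of (oddIdx i) * FreeGroup.of (evenIdx i) *
      (FreeGroup.of (oddIdx i))⁻¹ * (FreeGroup.of (evenIdx i))⁻¹).prod

/-- The Eilenberg–Mac Lane 2-chain `c = ∑ i, (∂R/∂x_i, x_i)`. -/
def surfaceChain (g : ℕ) : (FreeGroup (Fin (2 * g)) × FreeGroup (Fin (2 * g))) →₀ ℤ :=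
  ∑ i, (foxDeriv i (surfaceRel g)).coeff.sum fun w n => Finsupp.single (w, FreeGroup.of i) n

/-! ## The 2-form -/

section TwoForm

variable {E : Type*} [NormedAddCommGroup E] [NormedSpace ℝ E]
  {G : Type*} [TopologicalSpace G] [ChartedSpace E G] [Group G]

variable (E) in
/-- The derivative `Ad_x` at the identity of the conjugation by `x`. -/
def Ad (x : G) : GroupLieAlgebra 𝓘(ℝ, E) G →L[ℝ] GroupLieAlgebra 𝓘(ℝ, E) G :=
  mfderiv 𝓘(ℝ, E) 𝓘(ℝ, E) (fun a : G => x * a * x⁻¹) 1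

variable (E G) in
/-- An inner product on the Lie algebra of `G` that is invariant under the adjoint action. -/
structure InvariantInner where
  inner : GroupLieAlgebra 𝓘(ℝ, E) G →L[ℝ] GroupLieAlgebra 𝓘(ℝ, E) G →L[ℝ] ℝ
  symm : ∀ u v, inner u v = inner v u
  pos : ∀ u, u ≠ 0 → 0 < inner u u
  invariant : ∀ (x : G) u v, inner (Ad E x u) (Ad E x v) = inner u v

variable (E) in
/-- The left-invariant Maurer–Cartan form of `G`. -/
def leftMC (x : G) : TangentSpace 𝓘(ℝ, E) x →L[ℝ] GroupLieAlgebra 𝓘(ℝ, E) G :=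
  mfderiv 𝓘(ℝ, E) 𝓘(ℝ, E) (fun a : G => x⁻¹ * a) x

variable (E) in
/-- The right-invariant Maurer–Cartan form of `G`. -/
def rightMC (x : G) : TangentSpace 𝓘(ℝ, E) x →L[ℝ] GroupLieAlgebra 𝓘(ℝ, E) G :=
  mfderiv 𝓘(ℝ, E) 𝓘(ℝ, E) (fun a : G => a * x⁻¹) x

/-- The wedge product of two Lie algebra valued covectors combined with the inner product:
`(a · b)(v₀, v₁) = a(v₀) · b(v₁) - a(v₁) · b(v₀)`. -/
def InvariantInner.wedge (B : InvariantInner E G) {V : Type*} [AddCommGroup V] [Module ℝ V]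
    [TopologicalSpace V] (a b : V →L[ℝ] GroupLieAlgebra 𝓘(ℝ, E) G) : V [⋀^Fin 2]→L[ℝ] ℝ where
  toFun v := B.inner (a (v 0)) (b (v 1)) - B.inner (a (v 1)) (b (v 0))
  map_update_add' := by
    intro hd v i x y
    obtain rfl := Subsingleton.elim hd (instDecidableEqFin 2)
    fin_cases i <;> simp <;> ring
  map_update_smul' := by
    intro hd v i r x
    obtain rfl := Subsingleton.elim hd (instDecidableEqFin 2)
    fin_cases i <;> simp <;> ring
  map_eq_zero_of_eq' := by
    intro v i j hv hij
    fin_cases i <;> fin_cases j <;> simp_all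
  cont := by
    have h : Continuous fun p : GroupLieAlgebra 𝓘(ℝ, E) G × GroupLieAlgebra 𝓘(ℝ, E) G =>
        B.inner p.1 p.2 :=
      ContinuousLinearMap.continuous₂ (E := E) (F := E) B.inner
    have h₁ : ∀ i j : Fin 2, Continuous fun v : Fin 2 → V => B.inner (a (v i)) (b (v j)) :=
      fun i j => h.comp ((a.continuous.comp (continuous_apply i)).prodMk
        (b.continuous.comp (continuous_apply j)))
    exact (h₁ 0 1).sub (h₁ 1 0)

/-- Weinstein's 2-form `Ω = θ₁ · θ̄₂` on `G × G`. -/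
def weinsteinForm (B : InvariantInner E G) :
    DiffForm (𝓘(ℝ, E).prod 𝓘(ℝ, E)) (G × G) 2 :=
  fun p => B.wedge
    ((leftMC E p.1).comp (mfderiv (𝓘(ℝ, E).prod 𝓘(ℝ, E)) 𝓘(ℝ, E) Prod.fst p))
    ((rightMC E p.2).comp (mfderiv (𝓘(ℝ, E).prod 𝓘(ℝ, E)) 𝓘(ℝ, E) Prod.snd p))

variable (E) in
/-- The model with corners of `G^m`. -/
abbrev powModel (m : ℕ) :
    ModelWithCorners ℝ (Fin m → E) (ModelPi fun _ : Fin m => E) :=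
  ModelWithCorners.pi fun _ : Fin m => 𝓘(ℝ, E)

/-- The evaluation of the word `w` on a tuple, that is, on a point of
`Hom(F_m, G) = G^m`. -/
def evalWord {G : Type*} [Group G] {m : ℕ} (w : FreeGroup (Fin m)) (y : Fin m → G) : G := FreeGroup.lift y w

/-- The form `ω = ⟨c, E^* Ω⟩` on `G^{2g}`: the sum over the terms `n (w₁, w₂)` of the chain `c`
of `n` times the pullback of `Ω` under `y ↦ (w₁(y), w₂(y))`. -/
def surfaceForm (g : ℕ) (B : InvariantInner E G) : DiffForm (powModel E (2 * g)) (Fin (2 * g) → G) 2 :=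
  fun y => (surfaceChain g).sum fun w n =>
    n • DiffForm.pullback (powModel E (2 * g)) (𝓘(ℝ, E).prod 𝓘(ℝ, E))
      (fun y : Fin (2 * g) → G => (evalWord w.1 y, evalWord w.2 y)) (weinsteinForm B) y

end TwoForm

/-! ## Level sets of the relation and relative character varieties -/

section LevelSet

variable {G : Type*} [Group G]

/-- `ε_R(y_1, …, y_{2g}) = ∏ [y_{2i-1}, y_{2i}]`. -/
def relEval (g : ℕ) (y : Fin (2 * g) → G) : G := evalWord (surfaceRel g) y

theorem relEval_eq (g : ℕ) (y : Fin (2 * g) → G) :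
    relEval g y = (List.ofFn fun i : Fin g =>
      y (oddIdx i) * y (evenIdx i) * (y (oddIdx i))⁻¹ * (y (evenIdx i))⁻¹).prod := by
  simp [relEval, evalWord, surfaceRel, map_list_prod, List.map_ofFn, Function.comp_def]

/-- The level set `Y_t = ε_R⁻¹(t)`. -/
def levelSet (g : ℕ) (t : G) : Set (Fin (2 * g) → G) := {y | relEval g y = t}

/-- Simultaneous conjugation of a tuple. -/
def conjTuple {m : ℕ} (x : G) (y : Fin m → G) : Fin m → G := fun i => x * y i * x⁻¹

theorem relEval_conjTuple (g : ℕ) (x : G) (y : Fin (2 * g) → G) :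
    relEval g (conjTuple x y) = x * relEval g y * x⁻¹ := by
  have h : FreeGroup.lift (conjTuple x y) = (MulAut.conj x).toMonoidHom.comp (FreeGroup.lift y) := by
    ext i
    simp [conjTuple]
  simp [relEval, evalWord, h]

/-- The centralizer `Z_t` acts on `Y_t` by conjugation. -/
instance levelSetAction (g : ℕ) (t : G) :
    MulAction (Subgroup.centralizer {t}) (levelSet g t) where
  smul z y := ⟨conjTuple (z : G) y.1, by
    have hz := Subgroup.mem_centralizer_singleton_iff.mp z.2
    have hy : relEval g y.1 = t := y.2
    change relEval g _ = t
    rw [relEval_conjTuple, hy, hz, mul_inv_cancel_right]⟩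
  one_smul y := Subtype.ext (by funext i; change 1 * y.1 i * 1⁻¹ = y.1 i; simp)
  mul_smul z z' y := Subtype.ext (by
    funext i
    change (z * z' : G) * y.1 i * (z * z' : G)⁻¹ = z * (z' * y.1 i * (z' : G)⁻¹) * (z : G)⁻¹
    simp [mul_assoc])

/-- The relative character variety `M_t = Y_t / Z_t`. -/
abbrev RelCharVar (g : ℕ) (t : G) : Type _ :=
  MulAction.orbitRel.Quotient (Subgroup.centralizer {t}) (levelSet g t)

variable {E : Type*} [NormedAddCommGroup E] [NormedSpace ℝ E]
  [TopologicalSpace G] [ChartedSpace E G]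

variable (E) in
/-- The (Zariski) tangent space at `y` of the level set of `ε_R` through `y`. -/
def levelTangent (g : ℕ) (y : Fin (2 * g) → G) :
    Submodule ℝ (TangentSpace (powModel E (2 * g)) y) :=
  LinearMap.ker (mfderiv (powModel E (2 * g)) 𝓘(ℝ, E) (relEval g) y).toLinearMap

variable (E) in
/-- The Lie algebra of the centralizer `Z_t`: the vectors fixed by `Ad_t`. -/
def centralizerLie (t : G) : Submodule ℝ (GroupLieAlgebra 𝓘(ℝ, E) G) :=
  LinearMap.ker ((Ad E t).toLinearMap - LinearMap.id)

variable (E) in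
/-- The linear map `η ↦ η̃(y)`, where `η̃` is the vector field on `G^m` generated by `η` under
the conjugation action. -/
def conjGenerator {m : ℕ} (y : Fin m → G) :
    GroupLieAlgebra 𝓘(ℝ, E) G →ₗ[ℝ] TangentSpace (powModel E m) y :=
  (mfderiv 𝓘(ℝ, E) (powModel E m) (fun x : G => conjTuple x y) 1).toLinearMap

/-- The tangent space at `y` to the `Z_t`-orbit of `y ∈ Y_t`, as a subspace of the
tangent space of `Y_t`. -/
def orbitTangent (g : ℕ) (t : G) (y : levelSet g t) : Submodule ℝ (levelTangent E g y.1) :=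
  ((centralizerLie E t).map (conjGenerator E y.1)).comap (levelTangent E g y.1).subtype

variable (E) in
/-- The tangent space of `M_t` at the orbit of `y`, computed at the representative `y`:
`T_y Y_t` modulo the tangent space of the orbit. -/
abbrev QuotTangent (g : ℕ) (t : G) (y : levelSet g t) : Type _ :=
  levelTangent E g y.1 ⧸ orbitTangent (E := E) g t y

variable (E) in
/-- A (not necessarily smooth) 2-form on the relative character variety `M_t`: at each point `m`
of `M_t`, an alternating form on the tangent space of `M_t` at `m`. That space is computed at the
representatives `y` of `m`; the forms at the representatives `y` and `z • y` (`z ∈ Z_t`) are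
required to correspond under the identification induced by the derivative of the action
of `z`. -/
structure QuotTwoForm (g : ℕ) (t : G) where
  form : ∀ (m : RelCharVar g t) (y : levelSet g t), Quotient.mk _ y = m →
    QuotTangent E g t y [⋀^Fin 2]→ₗ[ℝ] ℝ
  compat : ∀ (m : RelCharVar g t) (y : levelSet g t) (z : Subgroup.centralizer {t})
    (hy : Quotient.mk _ y = m) (hzy : Quotient.mk _ (z • y) = m)
    (v : Fin 2 → levelTangent E g y.1) (v' : Fin 2 → levelTangent E g (z • y).1),
      (∀ j, (v' j).1 =
        mfderiv (powModel E (2 * g)) (powModel E (2 * g)) (conjTuple (z : G)) y.1 (v j).1) →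
      form m (z • y) hzy (fun j => Submodule.Quotient.mk (v' j)) =
        form m y hy (fun j => Submodule.Quotient.mk (v j))

namespace QuotTwoForm

variable {g : ℕ} {t : G}

/-- The form `φ` on `G^{2g}` descends to the form `β` on `M_t`: the pullback of `β` under the
quotient map `Y_t → M_t` is the restriction of `φ` to `Y_t`. -/
def IsDescentOf (β : QuotTwoForm E g t) (φ : DiffForm (powModel E (2 * g)) (Fin (2 * g) → G) 2) :
    Prop :=
  ∀ (y : levelSet g t) (v : Fin 2 → levelTangent E g y.1),
    β.form (Quotient.mk _ y) y rfl (fun j => Submodule.Quotient.mk (v j)) =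
      φ y.1 (fun j => (v j).1)

/-- `γ` is the pullback of `β` under the composition of `f : U → Y_t` with the quotient map. The
derivative of `f` is required to take its values in the tangent spaces of `Y_t`. -/
def IsPullback (β : QuotTwoForm E g t) {n : ℕ} (U : Set (EuclideanSpace ℝ (Fin n)))
    (f : EuclideanSpace ℝ (Fin n) → (Fin (2 * g) → G)) (hf : Set.MapsTo f U (levelSet g t))
    (γ : EuclideanSpace ℝ (Fin n) → EuclideanSpace ℝ (Fin n) [⋀^Fin 2]→L[ℝ] ℝ) : Prop :=
  ∀ (r : EuclideanSpace ℝ (Fin n)) (hr : r ∈ U) (a : Fin 2 → EuclideanSpace ℝ (Fin n)),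
    ∃ v : Fin 2 → levelTangent E g (f r),
      (∀ j, (v j).1 =
        mfderiv 𝓘(ℝ, EuclideanSpace ℝ (Fin n)) (powModel E (2 * g)) f r (a j)) ∧
      γ r a = β.form (Quotient.mk _ ⟨f r, hf hr⟩) ⟨f r, hf hr⟩ rfl
        (fun j => Submodule.Quotient.mk (v j))

/-- `β` is a smooth closed form on `M_t`: along every smooth map `f` from an open subset of a
Euclidean space to `Y_t`, its pullback is a smooth closed form. -/
def IsSmoothClosed (β : QuotTwoForm E g t) : Prop :=
  ∀ (n : ℕ) (U : Set (EuclideanSpace ℝ (Fin n)))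
    (f : EuclideanSpace ℝ (Fin n) → (Fin (2 * g) → G))
    (hf : DiffForm.IsPlotInto (powModel E (2 * g)) (levelSet g t) U f),
    ∃ γ : EuclideanSpace ℝ (Fin n) → EuclideanSpace ℝ (Fin n) [⋀^Fin 2]→L[ℝ] ℝ,
      β.IsPullback U f hf.2.2 γ ∧ DiffForm.IsSmoothClosedOn γ U

end QuotTwoForm

end LevelSet

end

noncomputable section

open Set Filter Topology

/-! ## Derivatives as maps between model spaces -/

section Mfd

variable {E₁ : Type*} [NormedAddCommGroup E₁] [NormedSpace ℝ E₁]
  {H₁ : Type*} [TopologicalSpace H₁] {I₁ : ModelWithCorners ℝ E₁ H₁}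
  {M₁ : Type*} [TopologicalSpace M₁] [ChartedSpace H₁ M₁]
  {E₂ : Type*} [NormedAddCommGroup E₂] [NormedSpace ℝ E₂]
  {H₂ : Type*} [TopologicalSpace H₂] {I₂ : ModelWithCorners ℝ E₂ H₂}
  {M₂ : Type*} [TopologicalSpace M₂] [ChartedSpace H₂ M₂]
  {E₃ : Type*} [NormedAddCommGroup E₃] [NormedSpace ℝ E₃]
  {H₃ : Type*} [TopologicalSpace H₃] {I₃ : ModelWithCorners ℝ E₃ H₃}
  {M₃ : Type*} [TopologicalSpace M₃] [ChartedSpace H₃ M₃]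

/-! For a word `w` let `θ_w` be the pullback to `Y` of the left Maurer–Cartan form under evaluation
of `w`, and let `χ(u, v, w) = [u, v] · w`. Both halves of the theorem come from writing something
built from `Ω` as a group coboundary `q(ab) - q(a) - q(b)` and pairing it with `c`. By
`surfaceChain_sum_boundary` the pairing collapses to `q(R) - q(1)`: the Fox formula gives `∑ ∂R/∂x_i
(x_i - 1) = R - 1`, and the remaining terms `q(x_i)` are weighted by the augmentations of `∂R/∂x_i`,
which vanish because `R` is a product of commutators.

For closedness, `q(w) = χ(θ_w)`. The Maurer–Cartan equations (`fderiv_darboux_sub`,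
`fderiv_adjoint_darboux_sub`) and the invariance of the inner product show that `dΩ`, pulled back
along `(a, b)`, is minus the coboundary of `q` (`extDeriv_weinsteinPullback`). Hence `dω = -ε_R^* χ`
(`extDeriv_surfacePullback`), which vanishes on vectors killed by `dε_R` and along maps into `Y_t`.

For descent, `q(w) = η · (θ_w + Ad_w θ_w)`. Its coboundary is the contraction of `Ω` with the
conjugation field of `η`, so contracting `ω` gives a 1-form pulled back by `ε_R`
(`surfaceForm_generator`), which is zero on `T_y Y_t`. Orbit directions thus lie in the radical of
the restricted form. With conjugation invariance (`surfaceForm_conjTuple`) this yields the form on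
`M_t`; uniqueness holds because tangent vectors of the quotient lift. -/

/-- The derivative of a map of manifolds, as a linear map between the model vector spaces. -/
def mfd (I₁ : ModelWithCorners ℝ E₁ H₁) (I₂ : ModelWithCorners ℝ E₂ H₂)
    (f : M₁ → M₂) (x : M₁) : E₁ →L[ℝ] E₂ :=
  mfderiv I₁ I₂ f x

theorem mfd_comp {g : M₂ → M₃} {f : M₁ → M₂} (x : M₁) (hg : MDifferentiableAt I₂ I₃ g (f x))
    (hf : MDifferentiableAt I₁ I₂ f x) :
    mfd I₁ I₃ (fun s => g (f s)) x = (mfd I₂ I₃ g (f x)).comp (mfd I₁ I₂ f x) :=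
  mfderiv_comp x hg hf

theorem mfd_comp_of_eq {g : M₂ → M₃} {f : M₁ → M₂} {x : M₁} {y : M₂} (hy : f x = y)
    (hg : MDifferentiableAt I₂ I₃ g y) (hf : MDifferentiableAt I₁ I₂ f x) :
    mfd I₁ I₃ (fun s => g (f s)) x = (mfd I₂ I₃ g y).comp (mfd I₁ I₂ f x) := by
  subst hy
  exact mfd_comp x hg hf

theorem mfd_congr {f g : M₁ → M₂} {x : M₁} (h : f =ᶠ[𝓝 x] g) :
    mfd I₁ I₂ f x = mfd I₁ I₂ g x :=
  h.mfderiv_eq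

theorem mfd_const (c : M₂) (x : M₁) : mfd I₁ I₂ (fun _ => c) x = 0 :=
  mfderiv_const

theorem mfd_id (x : M₁) : mfd I₁ I₁ (fun s => s) x = ContinuousLinearMap.id ℝ E₁ :=
  mfderiv_id

theorem mfd_eq_fderiv (f : E₁ → E₂) (x : E₁) :
    mfd 𝓘(ℝ, E₁) 𝓘(ℝ, E₂) f x = fderiv ℝ f x :=
  mfderiv_eq_fderiv

theorem mfd_prodMk {f : M₁ → M₂} {g : M₁ → M₃} {x : M₁}
    (hf : MDifferentiableAt I₁ I₂ f x) (hg : MDifferentiableAt I₁ I₃ g x) :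
    mfd I₁ (I₂.prod I₃) (fun s => (f s, g s)) x = (mfd I₁ I₂ f x).prod (mfd I₁ I₃ g x) :=
  hf.mfderiv_prod hg

theorem mfd_eq_add {f : M₁ × M₂ → M₃} {p : M₁ × M₂}
    (hf : MDifferentiableAt (I₁.prod I₂) I₃ f p) (v : E₁ × E₂) :
    mfd (I₁.prod I₂) I₃ f p v =
      mfd I₁ I₃ (fun z => f (z, p.2)) p.1 v.1 + mfd I₂ I₃ (fun z => f (p.1, z)) p.2 v.2 :=
  mfderiv_prod_eq_add_apply hf

end Mfd

/-! ## Darboux derivatives of maps into a Lie group -/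

section Darboux

variable {E : Type*} [NormedAddCommGroup E] [NormedSpace ℝ E]
  {G : Type*} [TopologicalSpace G] [ChartedSpace E G] [Group G]
  {E₁ : Type*} [NormedAddCommGroup E₁] [NormedSpace ℝ E₁]
  {H₁ : Type*} [TopologicalSpace H₁] {I₁ : ModelWithCorners ℝ E₁ H₁}
  {M₁ : Type*} [TopologicalSpace M₁] [ChartedSpace H₁ M₁]
  {E₂ : Type*} [NormedAddCommGroup E₂] [NormedSpace ℝ E₂]
  {H₂ : Type*} [TopologicalSpace H₂] {I₂ : ModelWithCorners ℝ E₂ H₂}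
  {M₂ : Type*} [TopologicalSpace M₂] [ChartedSpace H₂ M₂]

/-- The left Darboux (logarithmic) derivative of `a : M → G`, that is, the pullback under `a` of the
left-invariant Maurer–Cartan form. -/
def darboux (I₁ : ModelWithCorners ℝ E₁ H₁) (a : M₁ → G) (x : M₁) : E₁ →L[ℝ] E :=
  mfd I₁ 𝓘(ℝ, E) (fun s => (a x)⁻¹ * a s) x

variable (E) in
/-- The adjoint action on the model space. -/
def adjoint (x : G) : E →L[ℝ] E :=
  mfd 𝓘(ℝ, E) 𝓘(ℝ, E) (fun a : G => x * a * x⁻¹) 1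

theorem darboux_const (c : G) (x : M₁) :
    darboux I₁ (fun _ => c) x = (0 : E₁ →L[ℝ] E) :=
  mfd_const _ _

theorem darboux_const_mul (c : G) (a : M₁ → G) (x : M₁) :
    darboux I₁ (fun s => c * a s) x = (darboux I₁ a x : E₁ →L[ℝ] E) := by
  simp [darboux, mul_assoc]

theorem darboux_congr {a b : M₁ → G} {x : M₁} (h : a =ᶠ[𝓝 x] b) :
    (darboux I₁ a x : E₁ →L[ℝ] E) = darboux I₁ b x := by
  unfold darboux
  rw [h.self_of_nhds]
  exact mfd_congr (h.mono fun s hs => by simp only [hs])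

theorem adjoint_one : adjoint E (1 : G) = ContinuousLinearMap.id ℝ E := by
  unfold adjoint
  simpa using mfd_id (I₁ := 𝓘(ℝ, E)) (1 : G)

variable [LieGroup 𝓘(ℝ, E) ∞ G]

theorem MDifferentiableAt.groupMul {a b : M₁ → G} {x : M₁}
    (ha : MDifferentiableAt I₁ 𝓘(ℝ, E) a x) (hb : MDifferentiableAt I₁ 𝓘(ℝ, E) b x) :
    MDifferentiableAt I₁ 𝓘(ℝ, E) (fun s => a s * b s) x :=
  MDifferentiableAt.comp x
    (((contMDiff_mul 𝓘(ℝ, E) ∞ (G := G)).contMDiffAt (x := (a x, b x))).mdifferentiableAt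
      (by simp))
    (ha.prodMk hb)

theorem MDifferentiableAt.groupInv {a : M₁ → G} {x : M₁}
    (ha : MDifferentiableAt I₁ 𝓘(ℝ, E) a x) :
    MDifferentiableAt I₁ 𝓘(ℝ, E) (fun s => (a s)⁻¹) x :=
  MDifferentiableAt.comp x
    (((contMDiff_inv 𝓘(ℝ, E) ∞ (G := G)).contMDiffAt (x := a x)).mdifferentiableAt (by simp)) ha

theorem mdifferentiableAt_conj (x y : G) :
    MDifferentiableAt 𝓘(ℝ, E) 𝓘(ℝ, E) (fun a : G => x * a * x⁻¹) y :=
  (mdifferentiableAt_const.groupMul mdifferentiableAt_id).groupMul mdifferentiableAt_const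

/-- The differential of multiplication at `(1, 1)` is addition. All the calculus of logarithmic
derivatives below reduces to this case by translating values to the identity. -/
theorem mfd_mul_of_eq_one {a b : M₁ → G} {x : M₁} (ha : MDifferentiableAt I₁ 𝓘(ℝ, E) a x)
    (hb : MDifferentiableAt I₁ 𝓘(ℝ, E) b x) (hax : a x = 1) (hbx : b x = 1) :
    mfd I₁ 𝓘(ℝ, E) (fun s => a s * b s) x = mfd I₁ 𝓘(ℝ, E) a x + mfd I₁ 𝓘(ℝ, E) b x := by
  have hm : MDifferentiableAt (𝓘(ℝ, E).prod 𝓘(ℝ, E)) 𝓘(ℝ, E) (fun p : G × G => p.1 * p.2)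
      ((1, 1) : G × G) :=
    ((contMDiff_mul 𝓘(ℝ, E) ∞ (G := G)).contMDiffAt).mdifferentiableAt (by simp)
  have hfx : (fun s => (a s, b s)) x = ((1, 1) : G × G) := by simp [hax, hbx]
  have h := mfd_comp_of_eq (f := fun s => (a s, b s)) (g := fun p : G × G => p.1 * p.2) hfx hm
    (ha.prodMk hb)
  rw [mfd_prodMk ha hb] at h
  rw [h]
  ext v
  rw [ContinuousLinearMap.comp_apply, mfd_eq_add hm]
  simp [mfd_id]

theorem darboux_comp {a : M₂ → G} {f : M₁ → M₂} (x : M₁)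
    (ha : MDifferentiableAt I₂ 𝓘(ℝ, E) a (f x)) (hf : MDifferentiableAt I₁ I₂ f x) :
    darboux I₁ (fun s => a (f s)) x =
      (darboux I₂ a (f x) : E₂ →L[ℝ] E).comp (mfd I₁ I₂ f x) :=
  mfd_comp (g := fun s => (a (f x))⁻¹ * a s) x (mdifferentiableAt_const.groupMul ha) hf

theorem darboux_conj {a : M₁ → G} {x : M₁} (z : G) (ha : MDifferentiableAt I₁ 𝓘(ℝ, E) a x) :
    darboux I₁ (fun s => z * a s * z⁻¹) x = (adjoint E z).comp (darboux I₁ a x) := by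
  have : (fun s => (z * a x * z⁻¹)⁻¹ * (z * a s * z⁻¹)) =
      fun s => z * ((a x)⁻¹ * a s) * z⁻¹ := by
    funext s; group
  unfold darboux adjoint
  rw [this]
  exact mfd_comp_of_eq (g := fun a : G => z * a * z⁻¹) (by simp) (mdifferentiableAt_conj z 1)
    (mdifferentiableAt_const.groupMul ha)

/-- With `x` the base point, `(a(x) b(x))⁻¹ a(s) b(s)` is the product of `b(x)⁻¹ (a(x)⁻¹ a(s)) b(x)`
and `b(x)⁻¹ b(s)`. Both factors equal `1` at `s = x`, so their derivatives add. -/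
theorem darboux_mul {a b : M₁ → G} {x : M₁} (ha : MDifferentiableAt I₁ 𝓘(ℝ, E) a x)
    (hb : MDifferentiableAt I₁ 𝓘(ℝ, E) b x) :
    darboux I₁ (fun s => a s * b s) x =
      (adjoint E (b x)⁻¹).comp (darboux I₁ a x) + darboux I₁ b x := by
  rw [← darboux_conj _ ha]
  unfold darboux
  rw [← mfd_mul_of_eq_one
    (a := fun s => ((b x)⁻¹ * a x * (b x)⁻¹⁻¹)⁻¹ * ((b x)⁻¹ * a s * (b x)⁻¹⁻¹))
    (b := fun s => (b x)⁻¹ * b s) _ _ (by group) (by group)]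
  · congr 1
    funext s; group
  · exact mdifferentiableAt_const.groupMul
      ((mdifferentiableAt_const.groupMul ha).groupMul mdifferentiableAt_const)
  · exact mdifferentiableAt_const.groupMul hb

theorem adjoint_mul (x y : G) : adjoint E (x * y) = (adjoint E x).comp (adjoint E y) := by
  unfold adjoint
  rw [← mfd_comp_of_eq (by simp) (mdifferentiableAt_conj x 1) (mdifferentiableAt_conj y 1)]
  congr 1
  funext s; group

theorem adjoint_apply_inv (x : G) (v : E) : adjoint E x (adjoint E x⁻¹ v) = v := by
  rw [← ContinuousLinearMap.comp_apply, ← adjoint_mul, mul_inv_cancel, adjoint_one]; rfl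

theorem adjoint_inv_apply (x : G) (v : E) : adjoint E x⁻¹ (adjoint E x v) = v := by
  simpa using adjoint_apply_inv x⁻¹ v

theorem darboux_inv {a : M₁ → G} {x : M₁} (ha : MDifferentiableAt I₁ 𝓘(ℝ, E) a x) :
    darboux I₁ (fun s => (a s)⁻¹) x = -(adjoint E (a x)).comp (darboux I₁ a x) := by
  have h := darboux_mul ha ha.groupInv
  simp only [mul_inv_cancel, darboux_const, inv_inv] at h
  exact (neg_eq_of_add_eq_zero_right h.symm).symm

theorem leftMC_mfderiv {a : M₁ → G} {x : M₁} (ha : MDifferentiableAt I₁ 𝓘(ℝ, E) a x) (v : E₁) :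
    leftMC E (a x) (mfderiv I₁ 𝓘(ℝ, E) a x v) = darboux (E := E) I₁ a x v :=
  (DFunLike.congr_fun (mfd_comp (g := fun s => (a x)⁻¹ * s) x
    (mdifferentiableAt_const.groupMul mdifferentiableAt_id) ha) v).symm

/-- The identity `a(s) a(x)⁻¹ = a(x) (a(x)⁻¹ a(s)) a(x)⁻¹` makes the right-invariant form the
adjoint transform of the left-invariant one, so only left logarithmic derivatives are needed later.
-/
theorem rightMC_mfderiv {a : M₁ → G} {x : M₁} (ha : MDifferentiableAt I₁ 𝓘(ℝ, E) a x) (v : E₁) :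
    rightMC E (a x) (mfderiv I₁ 𝓘(ℝ, E) a x v) = adjoint E (a x) (darboux (E := E) I₁ a x v) := by
  rw [← ContinuousLinearMap.comp_apply, ← darboux_conj _ ha]
  simp only [darboux, mul_inv_rev, inv_inv, mul_assoc, inv_mul_cancel_left,
    mul_inv_cancel_left]
  exact (DFunLike.congr_fun (mfd_comp (g := fun s => s * (a x)⁻¹) x
    (mdifferentiableAt_id.groupMul mdifferentiableAt_const) ha) v).symm

end Darboux

/-! ## The Maurer–Cartan equation -/

section MaurerCartan

variable {E : Type*} [NormedAddCommGroup E] [NormedSpace ℝ E]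
  {G : Type*} [TopologicalSpace G] [ChartedSpace E G]
  {V : Type*} [NormedAddCommGroup V] [NormedSpace ℝ V]

theorem ContMDiffOn.mdifferentiableAt_of_isOpen {a : V → G} {U : Set V} (hU : IsOpen U)
    (ha : ContMDiffOn 𝓘(ℝ, V) 𝓘(ℝ, E) ∞ a U) {r : V} (hr : r ∈ U) :
    MDifferentiableAt 𝓘(ℝ, V) 𝓘(ℝ, E) a r :=
  (ha.contMDiffAt (hU.mem_nhds hr)).mdifferentiableAt (by simp)

variable [Group G]

variable (E G) in
/-- The inverse of the preferred chart at the identity. -/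
def chartOne : E → G := (extChartAt 𝓘(ℝ, E) (1 : G)).symm

variable (E G) in
/-- The coordinates of the identity in the preferred chart. -/
def originOne : E := extChartAt 𝓘(ℝ, E) (1 : G) 1

variable (E G) in
/-- The domain of the coordinates around the identity. -/
def targetOne : Set E := (extChartAt 𝓘(ℝ, E) (1 : G)).target

theorem isOpen_targetOne : IsOpen (targetOne E G) := isOpen_extChartAt_target 1

theorem originOne_mem : originOne E G ∈ targetOne E G := mem_extChartAt_target 1

theorem chartOne_origin : chartOne E G (originOne E G) = 1 := extChartAt_to_inv 1

variable (G) in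
/-- The bracket of the Lie algebra, in the form given by the Maurer–Cartan equation. -/
def mcBracket (u v : E) : E :=
  fderiv ℝ (darboux 𝓘(ℝ, E) (chartOne E G)) (originOne E G) v u -
    fderiv ℝ (darboux 𝓘(ℝ, E) (chartOne E G)) (originOne E G) u v

variable [LieGroup 𝓘(ℝ, E) ∞ G]

theorem mfd_extChartAt_one :
    mfd 𝓘(ℝ, E) 𝓘(ℝ, E) (extChartAt 𝓘(ℝ, E) (1 : G)) 1 = ContinuousLinearMap.id ℝ E :=
  have : IsManifold 𝓘(ℝ, E) 1 G := IsManifold.of_le (n := ∞) (by simp)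
  mfderiv_extChartAt_self

theorem mdifferentiableAt_extChartAt_one :
    MDifferentiableAt 𝓘(ℝ, E) 𝓘(ℝ, E) (extChartAt 𝓘(ℝ, E) (1 : G)) 1 :=
  have : IsManifold 𝓘(ℝ, E) 1 G := IsManifold.of_le (n := ∞) (by simp)
  mdifferentiableAt_extChartAt (mem_chart_source E 1)

theorem fderiv_extChartAt_comp {a : V → G} {r : V} (har : a r = 1)
    (ha : MDifferentiableAt 𝓘(ℝ, V) 𝓘(ℝ, E) a r) :
    fderiv ℝ (fun s => extChartAt 𝓘(ℝ, E) (1 : G) (a s)) r = mfd 𝓘(ℝ, V) 𝓘(ℝ, E) a r := by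
  rw [← mfd_eq_fderiv, mfd_comp_of_eq har mdifferentiableAt_extChartAt_one ha,
    mfd_extChartAt_one, ContinuousLinearMap.id_comp]

/-- The base point enters both as a parameter and as the point of differentiation. Separating the
two roles in `F(s, t) = a(s)⁻¹ a(t)`, which is near `1` around the diagonal, exhibits the
logarithmic derivative as a partial derivative of one smooth function, read in the chart at `1` and
restricted to the diagonal. -/
theorem contDiffOn_darboux {a : V → G} {U : Set V} (hU : IsOpen U)
    (ha : ContMDiffOn 𝓘(ℝ, V) 𝓘(ℝ, E) ∞ a U) :
    ContDiffOn ℝ ∞ (darboux 𝓘(ℝ, V) a : V → V →L[ℝ] E) U := by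
  set F : V × V → G := fun p => (a p.1)⁻¹ * a p.2
  have hF : ContMDiffOn 𝓘(ℝ, V × V) 𝓘(ℝ, E) ∞ F (U ×ˢ U) :=
    ((ha.comp contDiff_fst.contMDiff.contMDiffOn fun p hp => hp.1).inv).mul
      (ha.comp contDiff_snd.contMDiff.contMDiffOn fun p hp => hp.2)
  set W : Set (V × V) := (U ×ˢ U) ∩ F ⁻¹' (extChartAt 𝓘(ℝ, E) (1 : G)).source
  have hW : IsOpen W :=
    hF.continuousOn.isOpen_inter_preimage (hU.prod hU) (isOpen_extChartAt_source 1)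
  have hφ : ContDiffOn ℝ ∞ (fun p => extChartAt 𝓘(ℝ, E) (1 : G) (F p)) W := by
    rw [← contMDiffOn_iff_contDiffOn]
    exact (contMDiffOn_extChartAt (n := ∞)).comp (hF.mono inter_subset_left) fun p hp => by
      simpa using hp.2
  have hd : ∀ s ∈ U, (s, s) ∈ W := fun s hs => ⟨⟨hs, hs⟩, by simp [F]⟩
  have hφ' : ContDiffOn ℝ ∞ (fderiv ℝ fun p => extChartAt 𝓘(ℝ, E) (1 : G) (F p)) W :=
    hφ.fderiv_of_isOpen hW (by simp)
  have hs : ContDiffOn ℝ ∞ (fun s => (fderiv ℝ (fun p => extChartAt 𝓘(ℝ, E) (1 : G) (F p))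
      (s, s)).comp (ContinuousLinearMap.inr ℝ V V)) U :=
    (hφ'.comp (contDiff_id.prodMk contDiff_id).contDiffOn hd).clm_comp contDiffOn_const
  refine hs.congr fun s hs => ?_
  have haF : MDifferentiableAt 𝓘(ℝ, V) 𝓘(ℝ, E) (fun t => F (s, t)) s :=
    (mdifferentiableAt_const (c := (a s)⁻¹)).groupMul (ha.mdifferentiableAt_of_isOpen hU hs)
  have h1 := fderiv_extChartAt_comp (by simp [F]) haF
  change mfd 𝓘(ℝ, V) 𝓘(ℝ, E) (fun t => F (s, t)) s = _
  rw [← h1]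
  have hin : HasFDerivAt (fun t : V => (s, t)) (ContinuousLinearMap.inr ℝ V V) s :=
    hasFDerivAt_prodMk_right s s
  exact ((((hφ.contDiffAt (hW.mem_nhds (hd s hs))).differentiableAt (by simp)).hasFDerivAt).comp
    s hin).fderiv

theorem contMDiffOn_chartOne : ContMDiffOn 𝓘(ℝ, E) 𝓘(ℝ, E) ∞ (chartOne E G) (targetOne E G) :=
  contMDiffOn_extChartAt_symm 1

theorem mfd_chartOne_origin :
    mfd 𝓘(ℝ, E) 𝓘(ℝ, E) (chartOne E G) (originOne E G) = ContinuousLinearMap.id ℝ E := by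
  rw [← fderiv_extChartAt_comp chartOne_origin
    (contMDiffOn_chartOne.mdifferentiableAt_of_isOpen isOpen_targetOne originOne_mem)]
  have : (fun s => extChartAt 𝓘(ℝ, E) (1 : G) (chartOne E G s)) =ᶠ[𝓝 (originOne E G)] id :=
    Filter.eventuallyEq_of_mem (isOpen_targetOne.mem_nhds (originOne_mem (G := G)))
      fun s hs => (extChartAt 𝓘(ℝ, E) (1 : G)).right_inv hs
  rw [this.fderiv_eq, fderiv_id]

theorem darboux_chartOne_origin :
    darboux 𝓘(ℝ, E) (chartOne E G) (originOne E G) = ContinuousLinearMap.id ℝ E := by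
  simp only [darboux, chartOne_origin, inv_one, one_mul]
  exact mfd_chartOne_origin

/-- The Maurer–Cartan equation `dθ(u, v) = -[θ(u), θ(v)]`. -/
theorem fderiv_darboux_sub {a : V → G} {U : Set V} (hU : IsOpen U)
    (ha : ContMDiffOn 𝓘(ℝ, V) 𝓘(ℝ, E) ∞ a U) {r : V} (hr : r ∈ U) (u v : V) :
    fderiv ℝ (darboux 𝓘(ℝ, V) a) r u v - fderiv ℝ (darboux 𝓘(ℝ, V) a) r v u =
      -mcBracket G (darboux 𝓘(ℝ, V) a r u) (darboux (E := E) 𝓘(ℝ, V) a r v) := by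
  -- Left translation does not change the logarithmic derivative, so the value at `r` may be moved
  -- to `1`, where a single fixed chart serves for every map.
  set a' : V → G := fun s => (a r)⁻¹ * a s
  have ha' : ContMDiffOn 𝓘(ℝ, V) 𝓘(ℝ, E) ∞ a' U := contMDiffOn_const.mul ha
  have har : a' r = 1 := by simp [a']
  set W : Set V := U ∩ a' ⁻¹' (extChartAt 𝓘(ℝ, E) (1 : G)).source
  have hW : IsOpen W :=
    ha'.continuousOn.isOpen_inter_preimage hU (isOpen_extChartAt_source 1)
  have hrW : r ∈ W := ⟨hr, by simp [har]⟩
  set α : V → E := fun s => extChartAt 𝓘(ℝ, E) (1 : G) (a' s)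
  have hα : ContDiffOn ℝ ∞ α W := by
    rw [← contMDiffOn_iff_contDiffOn]
    exact (contMDiffOn_extChartAt (n := ∞)).comp (ha'.mono inter_subset_left) fun p hp => by
      simpa using hp.2
  have hαr : α r = originOne E G := by simp [α, har, originOne]
  have hαW : MapsTo α W (targetOne E G) := fun s hs =>
    (extChartAt 𝓘(ℝ, E) (1 : G)).map_source hs.2
  have hdα : ContDiffOn ℝ ∞ (fderiv ℝ α) W := hα.fderiv_of_isOpen hW (by simp)
  have hαd : ∀ s ∈ W, DifferentiableAt ℝ α s := fun s hs =>
    (hα.contDiffAt (hW.mem_nhds hs)).differentiableAt (by simp)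
  have hΘ : ContDiffOn ℝ ∞ (darboux 𝓘(ℝ, E) (chartOne E G)) (targetOne E G) :=
    contDiffOn_darboux isOpen_targetOne contMDiffOn_chartOne
  -- In coordinates `θ = Θ(α) ∘ Dα`, where `Θ` is the logarithmic derivative of the inverse chart.
  -- On antisymmetrizing its derivative, the second derivative of `α` cancels by symmetry; only the
  -- derivative of `Θ` at the origin is left, and that defines the bracket.
  have key : ∀ s ∈ W, darboux (E := E) 𝓘(ℝ, V) a s =
      (darboux 𝓘(ℝ, E) (chartOne E G) (α s)).comp (fderiv ℝ α s) := by
    intro s hs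
    rw [← mfd_eq_fderiv, ← darboux_comp s
      (contMDiffOn_chartOne.mdifferentiableAt_of_isOpen isOpen_targetOne (hαW hs))
      (hαd s hs).mdifferentiableAt, ← darboux_const_mul (E := E) (a r)⁻¹ a]
    refine (darboux_congr (E := E) (Filter.eventuallyEq_of_mem (hW.mem_nhds hs) fun x hx => ?_))
    exact ((extChartAt 𝓘(ℝ, E) (1 : G)).left_inv hx.2).symm
  have hd : HasFDerivAt (darboux (E := E) 𝓘(ℝ, E) (chartOne E G))
      (fderiv ℝ (darboux 𝓘(ℝ, E) (chartOne E G)) (originOne E G)) (α r) := by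
    rw [hαr]
    exact ((hΘ.contDiffAt (isOpen_targetOne.mem_nhds originOne_mem)).differentiableAt
      (by simp)).hasFDerivAt
  have h2 : HasFDerivAt (fderiv ℝ α) (fderiv ℝ (fderiv ℝ α) r) r :=
    ((hdα.contDiffAt (hW.mem_nhds hrW)).differentiableAt (by simp)).hasFDerivAt
  have hsymm : fderiv ℝ (fderiv ℝ α) r u v = fderiv ℝ (fderiv ℝ α) r v u :=
    (hα.contDiffAt (hW.mem_nhds hrW)).isSymmSndFDerivAt
      (by rw [minSmoothness_of_isRCLikeNormedField]; exact ENat.LEInfty.out) u v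
  have hder := ((hd.comp r (hαd r hrW).hasFDerivAt).clm_comp h2).congr_of_eventuallyEq
    (Filter.eventuallyEq_of_mem (hW.mem_nhds hrW) key)
  rw [hder.fderiv, key r hrW, hαr, darboux_chartOne_origin]
  simp [hαr, darboux_chartOne_origin, mcBracket, hsymm]

end MaurerCartan

/-! ## The invariant 3-form -/

section Bracket

variable {E : Type*} [NormedAddCommGroup E] [NormedSpace ℝ E]
  {G : Type*} [TopologicalSpace G] [ChartedSpace E G] [Group G]

theorem mcBracket_swap (u v : E) : mcBracket G u v = -mcBracket G v u := by
  simp [mcBracket]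

theorem mcBracket_add_left (u u' v : E) :
    mcBracket G (u + u') v = mcBracket G u v + mcBracket G u' v := by
  simp only [mcBracket, map_add, add_apply]; abel

theorem mcBracket_add_right (u v v' : E) :
    mcBracket G u (v + v') = mcBracket G u v + mcBracket G u v' := by
  simp only [mcBracket, map_add, add_apply]; abel

theorem mcBracket_neg_neg (u v : E) : mcBracket G (-u) (-v) = mcBracket G u v := by
  simp [mcBracket]

theorem mcBracket_zero_left (v : E) : mcBracket G 0 v = 0 := by
  simp [mcBracket]

variable [LieGroup 𝓘(ℝ, E) ∞ G]

theorem mdifferentiableAt_chartOne {s : E} (hs : s ∈ targetOne E G) :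
    MDifferentiableAt 𝓘(ℝ, E) 𝓘(ℝ, E) (chartOne E G) s :=
  contMDiffOn_chartOne.mdifferentiableAt_of_isOpen isOpen_targetOne hs

/-- The Maurer–Cartan equation holds both for the inverse chart and for its conjugate by `z`, whose
logarithmic derivative is `Ad_z` composed with that of the chart. Comparing the two equations at the
origin gives equivariance. -/
theorem mcBracket_adjoint (z : G) (u v : E) :
    mcBracket G (adjoint E z u) (adjoint E z v) = adjoint E z (mcBracket G u v) := by
  have hmem := isOpen_targetOne.mem_nhds (originOne_mem (E := E) (G := G))
  have hc : ContMDiffOn 𝓘(ℝ, E) 𝓘(ℝ, E) ∞ (fun s => z * chartOne E G s * z⁻¹)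
      (targetOne E G) := (contMDiffOn_const.mul contMDiffOn_chartOne).mul contMDiffOn_const
  have h1 := fderiv_darboux_sub isOpen_targetOne hc originOne_mem u v
  have h2 := fderiv_darboux_sub isOpen_targetOne contMDiffOn_chartOne
    (originOne_mem (E := E) (G := G)) u v
  have hd : DifferentiableAt ℝ (darboux (E := E) 𝓘(ℝ, E) (chartOne E G)) (originOne E G) :=
    ((contDiffOn_darboux isOpen_targetOne contMDiffOn_chartOne).contDiffAt hmem).differentiableAt
      (by simp)
  have he : darboux 𝓘(ℝ, E) (fun s => z * chartOne E G s * z⁻¹) =ᶠ[𝓝 (originOne E G)]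
      fun s => (adjoint E z).comp (darboux 𝓘(ℝ, E) (chartOne E G) s) :=
    Filter.eventuallyEq_of_mem hmem fun s hs => darboux_conj z (mdifferentiableAt_chartOne hs)
  have hf := ((hasFDerivAt_const (adjoint E z) (originOne E G)).clm_comp
    hd.hasFDerivAt).congr_of_eventuallyEq he
  rw [hf.fderiv, darboux_conj z (mdifferentiableAt_chartOne originOne_mem)] at h1
  rw [darboux_chartOne_origin] at h1 h2
  simp only [ContinuousLinearMap.id_apply] at h2
  rw [← neg_eq_iff_eq_neg] at h2
  simp only [ContinuousLinearMap.comp_id] at h1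
  rw [← neg_eq_iff_eq_neg] at h1
  rw [← h1, ← h2]
  simp

variable {B : E →L[ℝ] E →L[ℝ] ℝ}

/-- This is the derivative at `q = 1` of the invariance `Ad_{q⁻¹} u · Ad_{q⁻¹} w = u · w`. The
derivative of `Ad_{q⁻¹} u` is identified with a bracket by the Maurer–Cartan equation for the
product of two charts. -/
theorem inner_mcBracket_skew (hB : ∀ (x : G) u v, B (adjoint E x u) (adjoint E x v) = B u v)
    (u v w : E) : B (mcBracket G u v) w + B u (mcBracket G w v) = 0 := by
  set e := originOne E G
  have hmem : targetOne E G ∈ 𝓝 e := isOpen_targetOne.mem_nhds originOne_mem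
  set m : E × E → G := fun p => chartOne E G p.1 * chartOne E G p.2
  set W := targetOne E G ×ˢ targetOne E G
  have hW : IsOpen W := isOpen_targetOne.prod isOpen_targetOne
  have he : (e, e) ∈ W := ⟨originOne_mem, originOne_mem⟩
  have hm : ContMDiffOn 𝓘(ℝ, E × E) 𝓘(ℝ, E) ∞ m W :=
    (contMDiffOn_chartOne.comp contDiff_fst.contMDiff.contMDiffOn fun p hp => hp.1).mul
      (contMDiffOn_chartOne.comp contDiff_snd.contMDiff.contMDiffOn fun p hp => hp.2)
  set D : E × E → E × E →L[ℝ] E := darboux 𝓘(ℝ, E × E) m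
  have hD : DifferentiableAt ℝ D (e, e) :=
    ((contDiffOn_darboux hW hm).contDiffAt (hW.mem_nhds he)).differentiableAt (by simp)
  have hval : ∀ p ∈ W, ∀ x : E × E, D p x = adjoint E (chartOne E G p.2)⁻¹
      (darboux 𝓘(ℝ, E) (chartOne E G) p.1 x.1) + darboux 𝓘(ℝ, E) (chartOne E G) p.2 x.2 := by
    intro p hp x
    have h1 : MDifferentiableAt 𝓘(ℝ, E × E) 𝓘(ℝ, E) (Prod.fst : E × E → E) p :=
      differentiableAt_fst.mdifferentiableAt
    have h2 : MDifferentiableAt 𝓘(ℝ, E × E) 𝓘(ℝ, E) (Prod.snd : E × E → E) p :=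
      differentiableAt_snd.mdifferentiableAt
    have hc1 := mdifferentiableAt_chartOne (E := E) (G := G) hp.1
    have hc2 := mdifferentiableAt_chartOne (E := E) (G := G) hp.2
    change darboux 𝓘(ℝ, E × E) (fun p : E × E => chartOne E G p.1 * chartOne E G p.2) p x = _
    rw [darboux_mul (a := fun p : E × E => chartOne E G p.1)
      (b := fun p : E × E => chartOne E G p.2) (hc1.comp p h1) (hc2.comp p h2), darboux_comp p hc1 h1,
      darboux_comp p hc2 h2, mfd_eq_fderiv, mfd_eq_fderiv, fderiv_fst, fderiv_snd]
    rfl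
  have hψ : ∀ u : E, HasFDerivAt (fun q => D (e, q) (u, 0))
      ((ContinuousLinearMap.apply ℝ E ((u, 0) : E × E)).comp
        ((fderiv ℝ D (e, e)).comp (ContinuousLinearMap.inr ℝ E E))) e := fun u =>
    (ContinuousLinearMap.apply ℝ E ((u, 0) : E × E)).hasFDerivAt.comp e
      (hD.hasFDerivAt.comp e (hasFDerivAt_prodMk_right e e))
  -- Of the two derivatives in the Maurer–Cartan equation at `(e, e)`, one vanishes because `D (p,
  -- e) (0, v)` does not depend on `p`.
  have hbr : ∀ u v : E, fderiv ℝ D (e, e) (0, v) (u, 0) = mcBracket G u v := by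
    intro u v
    have h1 : HasFDerivAt (fun p => D (p, e) (0, v))
      ((ContinuousLinearMap.apply ℝ E ((0, v) : E × E)).comp
        ((fderiv ℝ D (e, e)).comp (ContinuousLinearMap.inl ℝ E E))) e :=
      (ContinuousLinearMap.apply ℝ E ((0, v) : E × E)).hasFDerivAt.comp e
        (HasFDerivAt.comp (f := fun p : E => (p, e)) e hD.hasFDerivAt
          (hasFDerivAt_prodMk_left e e))
    have h2 : (fun p => D (p, e) (0, v)) =ᶠ[𝓝 e] fun _ => v :=
      Filter.eventuallyEq_of_mem hmem fun p hp => by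
        simp [hval (p, e) ⟨hp, originOne_mem⟩, e, darboux_chartOne_origin]
    have h3 := DFunLike.congr_fun (h1.unique ((hasFDerivAt_const v e).congr_of_eventuallyEq h2)) u
    have h4 := fderiv_darboux_sub hW hm he (u, 0) (0, v)
    change fderiv ℝ D (e, e) (u, 0) (0, v) - fderiv ℝ D (e, e) (0, v) (u, 0) =
      -mcBracket G (D (e, e) (u, 0)) (D (e, e) (0, v)) at h4
    have h5 : fderiv ℝ D (e, e) (u, 0) (0, v) = 0 := by simpa using h3
    rw [h5, hval _ he, hval _ he] at h4
    simpa [e, darboux_chartOne_origin, chartOne_origin, adjoint_one] using h4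
  have hconst : (fun q => B (D (e, q) (u, 0)) (D (e, q) (w, 0))) =ᶠ[𝓝 e] fun _ => B u w :=
    Filter.eventuallyEq_of_mem hmem fun q hq => by
      simp [hval (e, q) ⟨originOne_mem, hq⟩, e, darboux_chartOne_origin, hB]
  have hprod := (B.hasFDerivAt.comp e (hψ u)).clm_apply (hψ w)
  have := DFunLike.congr_fun
    (hprod.unique ((hasFDerivAt_const (B u w) e).congr_of_eventuallyEq hconst)) v
  have h0 : ∀ u : E, D (e, e) (u, 0) = u := fun u => by
    simp [hval _ he, e, darboux_chartOne_origin, chartOne_origin, adjoint_one]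
  simp [hbr, h0] at this
  linarith

end Bracket

/-! ## The pullback of Weinstein's form and its exterior derivative -/

section Wedge

variable {E : Type*} [NormedAddCommGroup E] [NormedSpace ℝ E]
  {G : Type*} [TopologicalSpace G] [ChartedSpace E G] [Group G]
  {V : Type*} [NormedAddCommGroup V] [NormedSpace ℝ V]

/-- The invariant inner product as a bilinear form on the model space. -/
def InvariantInner.bilin (B : InvariantInner E G) : E →L[ℝ] E →L[ℝ] ℝ := B.inner

theorem InvariantInner.bilin_comm (B : InvariantInner E G) (u v : E) :
    B.bilin u v = B.bilin v u := B.symm u v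

theorem InvariantInner.bilin_adjoint (B : InvariantInner E G) (x : G) (u v : E) :
    B.bilin (adjoint E x u) (adjoint E x v) = B.bilin u v := B.invariant x u v

/-- The wedge product of two covectors with values in the model space. -/
def InvariantInner.modelWedge (B : InvariantInner E G) (a b : V →L[ℝ] E) :
    V [⋀^Fin 2]→L[ℝ] ℝ := B.wedge (V := V) a b

theorem InvariantInner.modelWedge_apply (B : InvariantInner E G) (a b : V →L[ℝ] E)
    (v : Fin 2 → V) :
    B.modelWedge a b v = B.bilin (a (v 0)) (b (v 1)) - B.bilin (a (v 1)) (b (v 0)) := rfl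

/-- Boundedness supplies both smoothness of the wedge of smooth forms and the product rule for its
derivative. -/
theorem InvariantInner.isBoundedBilinearMap_modelWedge (B : InvariantInner E G) :
    IsBoundedBilinearMap ℝ fun p : (V →L[ℝ] E) × (V →L[ℝ] E) => B.modelWedge p.1 p.2 where
  add_left a a' b := by
    ext v; simp [InvariantInner.modelWedge_apply]; ring
  smul_left c a b := by
    ext v; simp [InvariantInner.modelWedge_apply]; ring
  add_right a b b' := by
    ext v; simp [InvariantInner.modelWedge_apply]; ring
  smul_right c a b := by
    ext v; simp [InvariantInner.modelWedge_apply]; ring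
  bound := by
    -- Each of the two terms contributes `‖B.bilin‖`; the extra `1` makes the constant strictly
    -- positive even if the norm is zero.
    refine ⟨2 * ‖B.bilin‖ + 1, by positivity, fun a b => ?_⟩
    refine ContinuousAlternatingMap.opNorm_le_bound _ (by positivity) fun v => ?_
    have h : ∀ i j : Fin 2, ‖B.bilin (a (v i)) (b (v j))‖ ≤
        ‖B.bilin‖ * ‖a‖ * ‖b‖ * (‖v i‖ * ‖v j‖) := fun i j =>
      calc ‖B.bilin (a (v i)) (b (v j))‖ ≤ ‖B.bilin‖ * ‖a (v i)‖ * ‖b (v j)‖ :=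
            B.bilin.le_opNorm₂ _ _
        _ ≤ ‖B.bilin‖ * (‖a‖ * ‖v i‖) * (‖b‖ * ‖v j‖) := by
            gcongr <;> exact ContinuousLinearMap.le_opNorm _ _
        _ = _ := by ring
    rw [InvariantInner.modelWedge_apply, Fin.prod_univ_two]
    refine (norm_sub_le _ _).trans ((add_le_add (h 0 1) (h 1 0)).trans ?_)
    have : 0 ≤ ‖a‖ * ‖b‖ * (‖v 0‖ * ‖v 1‖) := by positivity
    nlinarith

/-- The invariant 3-form `B([θ, θ], θ)`. -/
def InvariantInner.triple (B : InvariantInner E G) (x : Fin 3 → E) : ℝ :=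
  B.bilin (mcBracket G (x 0) (x 1)) (x 2)

theorem InvariantInner.triple_zero (B : InvariantInner E G) :
    B.triple (fun _ => 0) = 0 := by
  simp [InvariantInner.triple, mcBracket_zero_left]

variable [LieGroup 𝓘(ℝ, E) ∞ G]

theorem InvariantInner.triple_adjoint (B : InvariantInner E G) (z : G) (x : Fin 3 → E) :
    B.triple (fun i => adjoint E z (x i)) = B.triple x := by
  simp only [InvariantInner.triple, mcBracket_adjoint, B.bilin_adjoint]

theorem InvariantInner.bilin_mcBracket_rotate (B : InvariantInner E G) (u v w : E) :
    B.bilin (mcBracket G u v) w = B.bilin (mcBracket G v w) u := by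
  have h := inner_mcBracket_skew B.bilin_adjoint u v w
  rw [B.bilin_comm u, mcBracket_swap w v] at h
  simp only [map_neg, neg_apply] at h
  linarith

/-- The expansion of the invariant 3-form on a sum. -/
theorem InvariantInner.triple_add (B : InvariantInner E G) (x y : Fin 3 → E) :
    B.triple (fun i => x i + y i) - B.triple x - B.triple y =
      B.bilin (mcBracket G (x 0) (x 1)) (y 2) - B.bilin (mcBracket G (x 0) (x 2)) (y 1) +
        B.bilin (mcBracket G (x 1) (x 2)) (y 0) + B.bilin (x 0) (mcBracket G (y 1) (y 2)) -
        B.bilin (x 1) (mcBracket G (y 0) (y 2)) + B.bilin (x 2) (mcBracket G (y 0) (y 1)) := by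
  simp only [InvariantInner.triple, mcBracket_add_left, mcBracket_add_right, map_add,
    add_apply]
  -- Six mixed terms survive the subtraction. Cyclic rotations and bracket swaps bring them to
  -- common representatives on the two sides.
  rw [B.bilin_comm (x 0), B.bilin_comm (x 1), B.bilin_comm (x 2),
    B.bilin_mcBracket_rotate (x 0) (y 1) (y 2), B.bilin_mcBracket_rotate (y 0) (x 1) (y 2),
    B.bilin_mcBracket_rotate (x 1) (y 2) (y 0), B.bilin_mcBracket_rotate (x 0) (y 1) (x 2),
    B.bilin_mcBracket_rotate (y 1) (x 2) (x 0), mcBracket_swap (x 2) (x 0),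
    mcBracket_swap (y 2) (y 0), B.bilin_mcBracket_rotate (y 0) (x 1) (x 2)]
  simp only [map_neg, neg_apply]
  ring

/-- The pullback of Weinstein's form under `(a, b) : V → G × G`. -/
def weinsteinPullback (B : InvariantInner E G) (a b : V → G) (r : V) : V [⋀^Fin 2]→L[ℝ] ℝ :=
  B.modelWedge (darboux 𝓘(ℝ, V) a r) ((adjoint E (b r)).comp (darboux 𝓘(ℝ, V) b r))

variable {a b : V → G} {U : Set V}

/-- The right-invariant form along `b` is minus the left-invariant form along `b⁻¹`; smoothness and
the structure equation transfer from the left to the right through this. -/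
theorem eqOn_adjoint_darboux (hU : IsOpen U) (hb : ContMDiffOn 𝓘(ℝ, V) 𝓘(ℝ, E) ∞ b U) :
    EqOn (fun r => (adjoint E (b r)).comp (darboux 𝓘(ℝ, V) b r))
      (fun r => -darboux 𝓘(ℝ, V) (fun s => (b s)⁻¹) r) U := fun r hr => by
  simp [darboux_inv (hb.mdifferentiableAt_of_isOpen hU hr)]

theorem contDiffOn_adjoint_darboux (hU : IsOpen U) (hb : ContMDiffOn 𝓘(ℝ, V) 𝓘(ℝ, E) ∞ b U) :
    ContDiffOn ℝ ∞ (fun r => (adjoint E (b r)).comp (darboux 𝓘(ℝ, V) b r)) U :=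
  (contDiffOn_darboux hU hb.inv).neg.congr (eqOn_adjoint_darboux hU hb)

/-- The Maurer–Cartan equation for the right-invariant form. -/
theorem fderiv_adjoint_darboux_sub (hU : IsOpen U) (hb : ContMDiffOn 𝓘(ℝ, V) 𝓘(ℝ, E) ∞ b U)
    {r : V} (hr : r ∈ U) (u v : V) :
    fderiv ℝ (fun r => (adjoint E (b r)).comp (darboux 𝓘(ℝ, V) b r)) r u v -
        fderiv ℝ (fun r => (adjoint E (b r)).comp (darboux 𝓘(ℝ, V) b r)) r v u =
      mcBracket G (adjoint E (b r) (darboux 𝓘(ℝ, V) b r u))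
        (adjoint E (b r) (darboux 𝓘(ℝ, V) b r v)) := by
  have h := fderiv_darboux_sub hU hb.inv hr u v
  rw [darboux_inv (hb.mdifferentiableAt_of_isOpen hU hr)] at h
  simp only [neg_apply, mcBracket_neg_neg, ContinuousLinearMap.comp_apply] at h
  rw [((eqOn_adjoint_darboux hU hb).eventuallyEq_of_mem (hU.mem_nhds hr)).fderiv_eq,
    fderiv_fun_neg]
  simp only [neg_apply]
  rw [← neg_inj, ← h]
  abel

theorem contDiffOn_weinsteinPullback (B : InvariantInner E G) (hU : IsOpen U)
    (ha : ContMDiffOn 𝓘(ℝ, V) 𝓘(ℝ, E) ∞ a U) (hb : ContMDiffOn 𝓘(ℝ, V) 𝓘(ℝ, E) ∞ b U) :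
    ContDiffOn ℝ ∞ (weinsteinPullback B a b) U :=
  ContDiff.comp_contDiffOn (g := fun p : (V →L[ℝ] E) × (V →L[ℝ] E) => B.modelWedge p.1 p.2)
    B.isBoundedBilinearMap_modelWedge.contDiff ((contDiffOn_darboux hU ha).prodMk
      (contDiffOn_adjoint_darboux hU hb))

/-- Put `α = θ_a` and `β = Ad_b θ_b`. In `d(α · β) = dα · β - α · dβ` the structure equations for
`α` and `β` have opposite signs, so both terms enter negatively; together they are minus the mixed
terms of the cubic form at `α + β`. -/
theorem extDeriv_weinsteinPullback (B : InvariantInner E G) (hU : IsOpen U)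
    (ha : ContMDiffOn 𝓘(ℝ, V) 𝓘(ℝ, E) ∞ a U) (hb : ContMDiffOn 𝓘(ℝ, V) 𝓘(ℝ, E) ∞ b U)
    {r : V} (hr : r ∈ U) (v : Fin 3 → V) :
    extDeriv (weinsteinPullback B a b) r v =
      -(B.triple (fun i => darboux 𝓘(ℝ, V) (fun s => a s * b s) r (v i)) -
        B.triple (fun i => darboux 𝓘(ℝ, V) a r (v i)) -
        B.triple (fun i => darboux 𝓘(ℝ, V) b r (v i))) := by
  have hn := hU.mem_nhds hr
  set α := fun r => darboux (E := E) 𝓘(ℝ, V) a r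
  set β := fun r => (adjoint E (b r)).comp (darboux 𝓘(ℝ, V) b r)
  have hα : HasFDerivAt α (fderiv ℝ α r) r :=
    (((contDiffOn_darboux hU ha).contDiffAt hn).differentiableAt (by simp)).hasFDerivAt
  have hβ : HasFDerivAt β (fderiv ℝ β r) r :=
    (((contDiffOn_adjoint_darboux hU hb).contDiffAt hn).differentiableAt (by simp)).hasFDerivAt
  have hw : IsBoundedBilinearMap ℝ fun p : (V →L[ℝ] E) × (V →L[ℝ] E) => B.modelWedge p.1 p.2 :=
    B.isBoundedBilinearMap_modelWedge
  have hγ : HasFDerivAt (weinsteinPullback B a b)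
      ((hw.deriv (α r, β r)).comp ((fderiv ℝ α r).prod (fderiv ℝ β r))) r :=
    HasFDerivAt.comp (f := fun r => (α r, β r)) r (hw.hasFDerivAt (α r, β r)) (hα.prodMk hβ)
  -- Since `θ_{ab} = Ad_{b⁻¹} (α + β)`, invariance lets the cubic form of `θ_{ab}` be evaluated at
  -- `α + β`.
  have hprod : (fun i => darboux (E := E) 𝓘(ℝ, V) (fun s => a s * b s) r (v i)) =
      fun i => adjoint E (b r)⁻¹ (α r (v i) + β r (v i)) := by
    funext i
    rw [darboux_mul (ha.mdifferentiableAt_of_isOpen hU hr)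
      (hb.mdifferentiableAt_of_isOpen hU hr)]
    simp [α, β, adjoint_inv_apply]
  have hbβ : B.triple (fun i => darboux 𝓘(ℝ, V) b r (v i)) = B.triple fun i => β r (v i) :=
    (B.triple_adjoint (b r) _).symm
  rw [hprod, B.triple_adjoint, hbβ, B.triple_add, extDeriv, hγ.fderiv,
    ContinuousAlternatingMap.alternatizeUncurryFin_apply]
  have hA : ∀ u w, mcBracket G (α r u) (α r w) = fderiv ℝ α r w u - fderiv ℝ α r u w :=
    fun u w => by
      rw [← neg_sub, fderiv_darboux_sub hU ha hr u w, neg_neg]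
  have hB : ∀ u w, mcBracket G (β r u) (β r w) = fderiv ℝ β r u w - fderiv ℝ β r w u :=
    fun u w => (fderiv_adjoint_darboux_sub hU hb hr u w).symm
  simp only [hA, hB]
  refine (Fin.sum_univ_three _).trans ?_
  simp [Fin.removeNth_apply, InvariantInner.modelWedge_apply, Fin.succAbove, Fin.tail]
  ring

end Wedge

/-! ## The boundary of the surface chain -/

section Chain

variable {α : Type*} [DecidableEq α] {A : Type*} [AddCommGroup A]

/-- The additive extension to the group ring of a function on the group. -/
def ringEval {F : Type*} (q : F → A) : MonoidAlgebra ℤ F →+ A :=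
  (Finsupp.linearCombination ℤ q).toAddMonoidHom.comp
    (MonoidAlgebra.coeffAddEquiv (R := ℤ) (M := F)).toAddMonoidHom

theorem ringEval_apply {F : Type*} (q : F → A) (x : MonoidAlgebra ℤ F) :
    ringEval q x = x.coeff.sum fun w n => n • q w := rfl

theorem ringEval_of_mul {F : Type*} [Group F] (q : F → A) (v : F) (x : MonoidAlgebra ℤ F) :
    ringEval q (MonoidAlgebra.of ℤ F v * x) = ringEval (fun w => q (v * w)) x := by
  suffices h : (ringEval q).comp (AddMonoidHom.mulLeft (MonoidAlgebra.of ℤ F v)) =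
      ringEval fun w => q (v * w) from DFunLike.congr_fun h x
  refine MonoidAlgebra.addMonoidHom_ext fun w n => ?_
  simp [ringEval_apply, MonoidAlgebra.single_mul_single]

theorem foxDeriv_one (i : α) : foxDeriv i 1 = 0 := by
  have h := foxDeriv_mul i 1 1
  rwa [map_one, one_mul, one_mul, left_eq_add] at h

/-- The fundamental formula of the Fox calculus. -/
theorem sum_ringEval_foxDeriv [Fintype α] (w : FreeGroup α) (q : FreeGroup α → A) :
    ∑ i, ringEval (fun v => q (v * FreeGroup.of i) - q v) (foxDeriv i w) = q w - q 1 := by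
  have hmul : ∀ (x y : FreeGroup α) (q : FreeGroup α → A),
      ∑ i, ringEval (fun v => q (v * FreeGroup.of i) - q v) (foxDeriv i (x * y)) =
        ∑ i, ringEval (fun v => q (v * FreeGroup.of i) - q v) (foxDeriv i x) +
          ∑ i, ringEval (fun v => q (x * (v * FreeGroup.of i)) - q (x * v)) (foxDeriv i y) := by
    intro x y q
    simp only [foxDeriv_mul, map_add, Finset.sum_add_distrib, ringEval_of_mul, mul_assoc]
  -- The function `q` must vary: the product rule for `x * y` replaces it by its left translate by
  -- `x` in the second summand.
  induction w using FreeGroup.induction_on generalizing q with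
  | C1 => simp [foxDeriv_one]
  | of x =>
    rw [Finset.sum_eq_single x]
    · simp [foxDeriv_of, ringEval_apply, MonoidAlgebra.one_def]
    · intro i _ hi
      simp [foxDeriv_of, Ne.symm hi]
    · simp
  | inv_of x hx =>
    -- The product rule applied to `x⁻¹ x = 1`, whose left side is zero, determines the value at the
    -- inverse.
    have h := hmul (FreeGroup.of x)⁻¹ (FreeGroup.of x) q
    rw [inv_mul_cancel, hx fun v => q ((FreeGroup.of x)⁻¹ * v)] at h
    simp only [foxDeriv_one, map_zero, Finset.sum_const_zero, inv_mul_cancel, mul_one] at h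
    rw [eq_neg_of_add_eq_zero_left h.symm, neg_sub]
  | mul x y hx hy =>
    rw [hmul, hx, hy fun v => q (x * v), mul_one]
    abel

/-- The image of the Fox derivative under a constant function is additive on products. -/
theorem ringEval_const_foxDeriv_mul (i : α) (c : A) (v w : FreeGroup α) :
    ringEval (fun _ => c) (foxDeriv i (v * w)) =
      ringEval (fun _ => c) (foxDeriv i v) + ringEval (fun _ => c) (foxDeriv i w) := by
  rw [foxDeriv_mul, map_add, ringEval_of_mul]

/-- Pairing with a constant sees only the augmentation of `∂w/∂x_i`, which is the exponent sum of
`x_i` in `w`. It is additive in `w`, hence zero on products of commutators. -/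
theorem ringEval_const_foxDeriv_surfaceRel {g : ℕ} (i : Fin (2 * g)) (c : A) :
    ringEval (fun _ => c) (foxDeriv i (surfaceRel g)) = 0 := by
  have hinv : ∀ v : FreeGroup (Fin (2 * g)), ringEval (fun _ => c) (foxDeriv i v⁻¹) =
      -ringEval (fun _ => c) (foxDeriv i v) := fun v => by
    have h := ringEval_const_foxDeriv_mul i c v v⁻¹
    rw [mul_inv_cancel, foxDeriv_one, map_zero] at h
    exact (neg_eq_of_add_eq_zero_right h.symm).symm
  have hprod : ∀ l : List (FreeGroup (Fin (2 * g))),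
      (∀ v ∈ l, ringEval (fun _ => c) (foxDeriv i v) = 0) →
        ringEval (fun _ => c) (foxDeriv i l.prod) = 0 := by
    intro l
    induction l with
    | nil => simp [foxDeriv_one]
    | cons a l ih =>
      intro h
      rw [List.prod_cons, ringEval_const_foxDeriv_mul, h a (by simp),
        ih fun v hv => h v (by simp [hv]), add_zero]
  refine hprod _ fun v hv => ?_
  obtain ⟨j, rfl⟩ := List.mem_ofFn.mp hv
  simp only [ringEval_const_foxDeriv_mul, hinv]
  abel

theorem surfaceChain_sum {g : ℕ}
    (f : FreeGroup (Fin (2 * g)) × FreeGroup (Fin (2 * g)) → A) :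
    ((surfaceChain g).sum fun w n => n • f w) =
      ∑ i, ringEval (fun v => f (v, FreeGroup.of i)) (foxDeriv i (surfaceRel g)) := by
  change Finsupp.linearCombination ℤ f (surfaceChain g) = _
  simp [surfaceChain, map_finsuppSum, ringEval_apply]

/-- The boundary of the surface chain is `1 - R`. -/
theorem surfaceChain_sum_boundary {g : ℕ} (q : FreeGroup (Fin (2 * g)) → A) :
    ((surfaceChain g).sum fun w n => n • (q (w.1 * w.2) - q w.1 - q w.2)) =
      q (surfaceRel g) - q 1 := by
  have h : ∀ i : Fin (2 * g), ∀ x, ringEval (fun v => q (v * FreeGroup.of i) - q v -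
      q (FreeGroup.of i)) x = ringEval (fun v => q (v * FreeGroup.of i) - q v) x -
        ringEval (fun _ => q (FreeGroup.of i)) x := fun i x => by
    simp only [ringEval_apply, smul_sub, Finsupp.sum_sub]
  rw [surfaceChain_sum (fun w => q (w.1 * w.2) - q w.1 - q w.2)]
  simp only [h, ringEval_const_foxDeriv_surfaceRel, sub_zero, sum_ringEval_foxDeriv]

end Chain

/-! ## Powers of a manifold -/

section Power

variable {E : Type*} [NormedAddCommGroup E] [NormedSpace ℝ E]
  {G : Type*} [TopologicalSpace G] [ChartedSpace E G]
  {E₁ : Type*} [NormedAddCommGroup E₁] [NormedSpace ℝ E₁]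
  {H₁ : Type*} [TopologicalSpace H₁] {I₁ : ModelWithCorners ℝ E₁ H₁}
  {M₁ : Type*} [TopologicalSpace M₁] [ChartedSpace H₁ M₁] {m : ℕ}

instance powModel_boundaryless : (powModel E m).Boundaryless where
  range_eq_univ := eq_univ_of_forall fun p => ⟨p, rfl⟩

theorem contMDiff_proj (i : Fin m) :
    ContMDiff (powModel E m) 𝓘(ℝ, E) ∞ fun y : Fin m → G => y i := by
  intro y
  rw [contMDiffAt_iff]
  refine ⟨(continuous_apply i).continuousAt, ?_⟩
  refine (contDiff_apply ℝ E i).contDiffWithinAt.congr_of_eventuallyEq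
    (f := fun p : Fin m → E => p i) ?_ ?_
  · filter_upwards [extChartAt_target_mem_nhdsWithin (I := powModel E m) y] with p hp
    exact congr_fun ((extChartAt (powModel E m) y).right_inv hp) i
  · exact congr_fun ((extChartAt (powModel E m) y).right_inv (mem_extChartAt_target y)) i

theorem contMDiffAt_pow {f : M₁ → Fin m → G} {x : M₁}
    (hf : ∀ i, ContMDiffAt I₁ 𝓘(ℝ, E) ∞ (fun s => f s i) x) :
    ContMDiffAt I₁ (powModel E m) ∞ f x := by
  rw [contMDiffAt_iff_target]
  refine ⟨continuousAt_pi.2 fun i => (hf i).continuousAt, contMDiffAt_pi_space.2 fun i => ?_⟩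
  exact (contMDiffAt_iff_target.1 (hf i)).2

/-- A tangent vector at `x` is therefore its own coordinate vector in the preferred chart at `x`.
This relates the exterior derivative, computed in the chart, to vectors of the Zariski tangent
space. -/
theorem mfd_extChartAt_symm_self [I₁.Boundaryless] {x : M₁}
    (h : MDifferentiableAt 𝓘(ℝ, E₁) I₁ (extChartAt I₁ x).symm (extChartAt I₁ x x)) :
    mfd 𝓘(ℝ, E₁) I₁ (extChartAt I₁ x).symm (extChartAt I₁ x x) =
      ContinuousLinearMap.id ℝ E₁ := by
  have he : (fun p => extChartAt I₁ x ((extChartAt I₁ x).symm p)) =ᶠ[𝓝 (extChartAt I₁ x x)] id :=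
    Filter.eventuallyEq_of_mem (extChartAt_target_mem_nhds x)
      fun p hp => (extChartAt I₁ x).right_inv hp
  suffices hw : fderivWithin ℝ (writtenInExtChartAt 𝓘(ℝ, E₁) I₁ (extChartAt I₁ x x)
      (extChartAt I₁ x).symm) (range 𝓘(ℝ, E₁)) (extChartAt I₁ x x) =
        ContinuousLinearMap.id ℝ E₁ from
    h.mfderiv.trans hw
  simp only [writtenInExtChartAt, mfld_simps, fderivWithin_univ]
  exact he.fderiv_eq.trans fderiv_id

variable [IsManifold 𝓘(ℝ, E) ∞ G]

theorem contMDiffOn_extChartAt_symm_pow (y : Fin m → G) :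
    ContMDiffOn 𝓘(ℝ, Fin m → E) (powModel E m) ∞ (extChartAt (powModel E m) y).symm
      (extChartAt (powModel E m) y).target := by
  intro p hp
  refine (contMDiffAt_pow fun i => ?_).contMDiffWithinAt
  have hpi : p i ∈ (extChartAt 𝓘(ℝ, E) (y i)).target := by
    have h := (extChartAt 𝓘(ℝ, E) (y i)).map_source
      (x := (extChartAt (powModel E m) y).symm p i) ?_
    · rwa [← congr_fun ((extChartAt (powModel E m) y).right_inv hp) i]
    · have h := (extChartAt (powModel E m) y).map_target hp
      rw [extChartAt_source] at h ⊢
      exact h i trivial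
  have h1 : ContMDiffAt 𝓘(ℝ, E) 𝓘(ℝ, E) ∞ (extChartAt 𝓘(ℝ, E) (y i)).symm (p i) :=
    (contMDiffOn_extChartAt_symm (y i)).contMDiffAt ((isOpen_extChartAt_target _).mem_nhds hpi)
  exact ContMDiffAt.comp p h1 (contDiff_apply ℝ E i).contMDiff.contMDiffAt

end Power

/-! ## The surface form along smooth maps -/

section Words

section Algebra

variable {G : Type*} [Group G] {m : ℕ}

theorem evalWord_one (y : Fin m → G) : evalWord 1 y = 1 := map_one _

theorem evalWord_mul (v w : FreeGroup (Fin m)) (y : Fin m → G) :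
    evalWord (v * w) y = evalWord v y * evalWord w y := map_mul _ _ _

theorem evalWord_conjTuple (w : FreeGroup (Fin m)) (x : G) (y : Fin m → G) :
    evalWord w (conjTuple x y) = x * evalWord w y * x⁻¹ := by
  have h : FreeGroup.lift (conjTuple x y) = (MulAut.conj x).toMonoidHom.comp (FreeGroup.lift y) := by
    ext i
    simp [conjTuple]
  simp [evalWord, h]

end Algebra

variable {E : Type*} [NormedAddCommGroup E] [NormedSpace ℝ E]
  {G : Type*} [TopologicalSpace G] [ChartedSpace E G] [Group G] {m : ℕ}

variable [LieGroup 𝓘(ℝ, E) ∞ G]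

theorem contMDiff_evalWord (w : FreeGroup (Fin m)) :
    ContMDiff (powModel E m) 𝓘(ℝ, E) ∞ (evalWord w : (Fin m → G) → G) := by
  induction w using FreeGroup.induction_on with
  | C1 =>
    have : (evalWord 1 : (Fin m → G) → G) = fun _ => 1 := funext evalWord_one
    rw [this]
    exact contMDiff_const
  | of i =>
    have : (evalWord (FreeGroup.of i) : (Fin m → G) → G) = fun y => y i :=
      funext fun y => by simp [evalWord]
    exact this ▸ contMDiff_proj i
  | inv_of i h =>
    have : (evalWord (FreeGroup.of i)⁻¹ : (Fin m → G) → G) =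
        fun y => (evalWord (FreeGroup.of i) y)⁻¹ := funext fun y => map_inv _ _
    rw [this]
    exact h.inv
  | mul v w hv hw =>
    have : (evalWord (v * w) : (Fin m → G) → G) = fun y => evalWord v y * evalWord w y :=
      funext fun y => evalWord_mul v w y
    rw [this]
    exact hv.mul hw

theorem mdifferentiableAt_evalWord (w : FreeGroup (Fin m)) (y : Fin m → G) :
    MDifferentiableAt (powModel E m) 𝓘(ℝ, E) (evalWord w) y :=
  (contMDiff_evalWord w y).mdifferentiableAt (by simp)

theorem contMDiff_conjTuple (x : G) :
    ContMDiff (powModel E m) (powModel E m) ∞ (conjTuple x : (Fin m → G) → Fin m → G) :=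
  fun y => contMDiffAt_pow fun i =>
    ((contMDiff_const.mul (contMDiff_proj i)).mul contMDiff_const) y

theorem contMDiff_conjTuple_left (y : Fin m → G) :
    ContMDiff 𝓘(ℝ, E) (powModel E m) ∞ (fun x : G => conjTuple x y) :=
  fun x => contMDiffAt_pow fun _ =>
    ((contMDiff_id.mul contMDiff_const).mul contMDiff_id.inv) x

variable {g : ℕ}

theorem weinsteinForm_pullback_apply (B : InvariantInner E G)
    (w : FreeGroup (Fin m) × FreeGroup (Fin m)) (y : Fin m → G) (v : Fin 2 → Fin m → E) :
    DiffForm.pullback (powModel E m) (𝓘(ℝ, E).prod 𝓘(ℝ, E))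
        (fun y : Fin m → G => (evalWord w.1 y, evalWord w.2 y)) (weinsteinForm B) y v =
      B.modelWedge (darboux (powModel E m) (evalWord w.1) y)
        ((adjoint E (evalWord w.2 y)).comp (darboux (powModel E m) (evalWord w.2) y)) v := by
  have h1 := mdifferentiableAt_evalWord (E := E) w.1 y
  have h2 := mdifferentiableAt_evalWord (E := E) w.2 y
  have hL : ∀ u : Fin m → E, leftMC E (evalWord w.1 y)
      (mfderiv (𝓘(ℝ, E).prod 𝓘(ℝ, E)) 𝓘(ℝ, E) Prod.fst (evalWord w.1 y, evalWord w.2 y)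
        (mfderiv (powModel E m) (𝓘(ℝ, E).prod 𝓘(ℝ, E))
          (fun y : Fin m → G => (evalWord w.1 y, evalWord w.2 y)) y u)) =
      darboux (E := E) (powModel E m) (evalWord w.1) y u := fun u => by
    rw [← leftMC_mfderiv h1]
    exact congrArg (leftMC E (evalWord w.1 y)) (DFunLike.congr_fun
      (mfd_comp (g := Prod.fst) y mdifferentiableAt_fst (h1.prodMk h2)) u).symm
  have hR : ∀ u : Fin m → E, rightMC E (evalWord w.2 y)
      (mfderiv (𝓘(ℝ, E).prod 𝓘(ℝ, E)) 𝓘(ℝ, E) Prod.snd (evalWord w.1 y, evalWord w.2 y)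
        (mfderiv (powModel E m) (𝓘(ℝ, E).prod 𝓘(ℝ, E))
          (fun y : Fin m → G => (evalWord w.1 y, evalWord w.2 y)) y u)) =
      adjoint E (evalWord w.2 y) (darboux (E := E) (powModel E m) (evalWord w.2) y u) :=
    fun u => by
      rw [← rightMC_mfderiv h2]
      exact congrArg (rightMC E (evalWord w.2 y)) (DFunLike.congr_fun
        (mfd_comp (g := Prod.snd) y mdifferentiableAt_snd (h1.prodMk h2)) u).symm
  exact congrArg₂ (· - ·) (congrArg₂ (fun a b => B.bilin a b) (hL (v 0)) (hR (v 1)))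
    (congrArg₂ (fun a b => B.bilin a b) (hL (v 1)) (hR (v 0)))

theorem surfaceForm_apply (B : InvariantInner E G) (y : Fin (2 * g) → G)
    (v : Fin 2 → Fin (2 * g) → E) :
    surfaceForm g B y v = (surfaceChain g).sum fun w n => n •
      B.modelWedge (darboux (powModel E (2 * g)) (evalWord w.1) y)
        ((adjoint E (evalWord w.2 y)).comp (darboux (powModel E (2 * g)) (evalWord w.2) y)) v := by
  simp only [← weinsteinForm_pullback_apply]
  exact (ContinuousAlternatingMap.sum_apply _ v)

variable {V : Type*} [NormedAddCommGroup V] [NormedSpace ℝ V] {U : Set V}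
  {F : V → Fin (2 * g) → G}

theorem ContMDiffOn.evalWord (hF : ContMDiffOn 𝓘(ℝ, V) (powModel E (2 * g)) ∞ F U)
    (w : FreeGroup (Fin (2 * g))) :
    ContMDiffOn 𝓘(ℝ, V) 𝓘(ℝ, E) ∞ (fun r => evalWord w (F r)) U :=
  (contMDiff_evalWord w).comp_contMDiffOn hF

/-- The pullback of the surface form to a normed space. -/
def surfacePullback (B : InvariantInner E G) (F : V → Fin (2 * g) → G) (r : V) :
    V [⋀^Fin 2]→L[ℝ] ℝ :=
  DiffForm.pullback 𝓘(ℝ, V) (powModel E (2 * g)) F (surfaceForm g B) r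

/-- The chain rule absorbs `F` into the words, leaving a finite real combination of forms on a
normed space. Taking `F` to be an inverse chart or a plot, the same computation handles `ω` on `Y`
and its pullbacks. -/
theorem surfacePullback_eqOn (B : InvariantInner E G) (hU : IsOpen U)
    (hF : ContMDiffOn 𝓘(ℝ, V) (powModel E (2 * g)) ∞ F U) :
    EqOn (surfacePullback B F)
      (fun r => ∑ w ∈ (surfaceChain g).support, (surfaceChain g w : ℝ) •
        weinsteinPullback B (fun r => evalWord w.1 (F r)) (fun r => evalWord w.2 (F r)) r) U := by
  intro r hr
  have hFr : MDifferentiableAt 𝓘(ℝ, V) (powModel E (2 * g)) F r :=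
    (hF.contMDiffAt (hU.mem_nhds hr)).mdifferentiableAt (by simp)
  ext v
  refine (surfaceForm_apply B (F r) fun j => mfd 𝓘(ℝ, V) (powModel E (2 * g)) F r (v j)).trans ?_
  simp only [ContinuousAlternatingMap.sum_apply, ContinuousAlternatingMap.smul_apply, Finsupp.sum,
    zsmul_eq_mul, smul_eq_mul, weinsteinPullback, InvariantInner.modelWedge_apply,
    darboux_comp r (mdifferentiableAt_evalWord _ (F r)) hFr, ContinuousLinearMap.comp_apply]

theorem contDiffOn_surfacePullback (B : InvariantInner E G) (hU : IsOpen U)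
    (hF : ContMDiffOn 𝓘(ℝ, V) (powModel E (2 * g)) ∞ F U) :
    ContDiffOn ℝ ∞ (surfacePullback B F) U :=
  (ContDiffOn.sum fun w _ => (contDiffOn_weinsteinPullback B hU (hF.evalWord w.1)
    (hF.evalWord w.2)).const_smul _).congr (surfacePullback_eqOn B hU hF)

theorem extDeriv_sum_smul {n : ℕ} {ι : Type*} (s : Finset ι) (c : ι → ℝ)
    (φ : ι → V → V [⋀^Fin n]→L[ℝ] ℝ) (r : V) (hφ : ∀ i ∈ s, DifferentiableAt ℝ (φ i) r) :
    extDeriv (fun r => ∑ i ∈ s, c i • φ i r) r = ∑ i ∈ s, c i • extDeriv (φ i) r := by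
  simp only [extDeriv, ← ContinuousAlternatingMap.alternatizeUncurryFinCLM_apply]
  rw [fderiv_fun_sum (A := fun i r => c i • φ i r) fun i hi => (hφ i hi).const_smul (c i), map_sum]
  refine Finset.sum_congr rfl fun i hi => ?_
  rw [fderiv_fun_const_smul (hφ i hi), map_smul]

/-- The exterior derivative of the surface form is, up to sign, the pullback under `ε_R` of the
invariant 3-form. -/
theorem extDeriv_surfacePullback (B : InvariantInner E G) (hU : IsOpen U)
    (hF : ContMDiffOn 𝓘(ℝ, V) (powModel E (2 * g)) ∞ F U) {r : V} (hr : r ∈ U) (v : Fin 3 → V) :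
    extDeriv (surfacePullback B F) r v =
      -B.triple fun i => darboux 𝓘(ℝ, V) (fun r => relEval g (F r)) r (v i) := by
  have hn := hU.mem_nhds hr
  have hs := ((surfacePullback_eqOn B hU hF).eventuallyEq_of_mem hn).extDeriv_eq
  rw [hs, extDeriv_sum_smul _ _ _ _ fun w _ => ((contDiffOn_weinsteinPullback B hU
    (hF.evalWord w.1) (hF.evalWord w.2)).contDiffAt hn).differentiableAt (by simp)]
  have hq := surfaceChain_sum_boundary (g := g) fun w =>
    B.triple fun i => darboux 𝓘(ℝ, V) (fun r => evalWord w (F r)) r (v i)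
  have h1 : B.triple (fun i => darboux 𝓘(ℝ, V) (fun r => evalWord 1 (F r)) r (v i)) = 0 := by
    simp only [evalWord_one, darboux_const, zero_apply]
    exact B.triple_zero
  rw [h1, sub_zero] at hq
  unfold relEval
  rw [← hq]
  simp only [ContinuousAlternatingMap.sum_apply, ContinuousAlternatingMap.smul_apply, Finsupp.sum,
    zsmul_eq_mul, smul_eq_mul, extDeriv_weinsteinPullback B hU (hF.evalWord _) (hF.evalWord _) hr,
    evalWord_mul, mul_neg, Finset.sum_neg_distrib]

end Words

/-! ## Descent to the relative character variety -/

/-- Vanishing is assumed only when the first argument lies in `O`; antisymmetry extends it to the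
second, so the arguments may be changed one at a time. -/
theorem AlternatingMap.eq_of_sub_mem {W : Type*} [AddCommGroup W] [Module ℝ W]
    (φ : W [⋀^Fin 2]→ₗ[ℝ] ℝ) (O : Submodule ℝ W) (h : ∀ v, v 0 ∈ O → φ v = 0)
    {v v' : Fin 2 → W} (hv : ∀ j, v' j - v j ∈ O) : φ v' = φ v := by
  have hl : ∀ x x' y, x' - x ∈ O → φ ![x', y] = φ ![x, y] := fun x x' y hx => by
    have h1 := φ.map_vecCons_add ![y] x (x' - x)
    rwa [add_sub_cancel, h ![x' - x, y] hx, add_zero] at h1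
  have hsw : ∀ x y, φ ![x, y] = -φ ![y, x] := fun x y => by
    rw [← φ.map_swap ![y, x] (show (0 : Fin 2) ≠ 1 by decide)]
    congr 1
    funext i
    fin_cases i <;> rfl
  have he : ∀ u : Fin 2 → W, u = ![u 0, u 1] := fun u => by
    funext i
    fin_cases i <;> rfl
  rw [he v', he v, hl (v 0) (v' 0) _ (hv 0), hsw, hl (v 1) (v' 1) _ (hv 1), ← hsw]

section Descent

variable {E : Type*} [NormedAddCommGroup E] [NormedSpace ℝ E]
  {G : Type*} [TopologicalSpace G] [ChartedSpace E G] [Group G] {g : ℕ} {t : G}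

/-- The restriction of the surface form to the tangent space of the level set. -/
def restrictedForm (B : InvariantInner E G) (y : Fin (2 * g) → G) :
    levelTangent E g y [⋀^Fin 2]→ₗ[ℝ] ℝ :=
  (surfaceForm g B y).toAlternatingMap.compLinearMap (levelTangent E g y).subtype

/-- A linear section of the projection of the tangent space of the level set to the tangent
space of the relative character variety. -/
def quotSection (y : levelSet g t) : QuotTangent E g t y →ₗ[ℝ] levelTangent E g y.1 :=
  Classical.choose ((orbitTangent (E := E) g t y).mkQ.exists_rightInverse_of_surjective
    (Submodule.range_mkQ _))

theorem mk_quotSection (y : levelSet g t) (u : QuotTangent E g t y) :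
    Submodule.Quotient.mk (quotSection y u) = u :=
  LinearMap.congr_fun (Classical.choose_spec
    ((orbitTangent (E := E) g t y).mkQ.exists_rightInverse_of_surjective
      (Submodule.range_mkQ _))) u

theorem QuotTwoForm.IsDescentOf.unique {β β' : QuotTwoForm E g t}
    {φ : DiffForm (powModel E (2 * g)) (Fin (2 * g) → G) 2} (h : β.IsDescentOf φ)
    (h' : β'.IsDescentOf φ) : β' = β := by
  suffices hf : β'.form = β.form by
    cases β; cases β'; cases hf; rfl
  funext m y hy
  subst hy
  refine AlternatingMap.ext fun u => ?_
  choose v hv using fun j => Submodule.Quotient.mk_surjective _ (u j)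
  obtain rfl : (fun j => Submodule.Quotient.mk (v j)) = u := funext hv
  exact (h' y v).trans (h y v).symm

variable {n : ℕ} {U : Set (EuclideanSpace ℝ (Fin n))}
  {f : EuclideanSpace ℝ (Fin n) → Fin (2 * g) → G}

theorem relEval_plot_eventuallyEq (hf : DiffForm.IsPlotInto (powModel E (2 * g)) (levelSet g t) U f)
    {r : EuclideanSpace ℝ (Fin n)} (hr : r ∈ U) :
    (fun r => relEval g (f r)) =ᶠ[𝓝 r] fun _ => t :=
  Filter.eventuallyEq_of_mem (hf.1.mem_nhds hr) hf.2.2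

theorem darboux_id_one (η : E) : darboux 𝓘(ℝ, E) (fun x : G => x) 1 η = η := by
  simp [darboux, mfd_id]

variable [LieGroup 𝓘(ℝ, E) ∞ G]

theorem darboux_conj_left (c : G) (η : E) :
    darboux 𝓘(ℝ, E) (fun x : G => x * c * x⁻¹) 1 η = adjoint E c⁻¹ η - η := by
  have hid : MDifferentiableAt 𝓘(ℝ, E) 𝓘(ℝ, E) (fun x : G => x) 1 := mdifferentiableAt_id
  have hc : MDifferentiableAt 𝓘(ℝ, E) 𝓘(ℝ, E) (fun _ : G => c) 1 := mdifferentiableAt_const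
  rw [darboux_mul (hid.groupMul hc) hid.groupInv, darboux_mul hid hc, darboux_inv hid,
    darboux_const]
  simp [adjoint_one, darboux_id_one, sub_eq_add_neg]

/-- Evaluation of a word is equivariant for conjugation, so the orbit of the tuple maps to the
conjugation orbit of the single element `evalWord w y`. -/
theorem darboux_evalWord_generator {m : ℕ} (w : FreeGroup (Fin m)) (y : Fin m → G) (η : E) :
    darboux (powModel E m) (evalWord w) y
        (mfd 𝓘(ℝ, E) (powModel E m) (fun x : G => conjTuple x y) 1 η) =
      adjoint E (evalWord w y)⁻¹ η - η := by
  have h1 : conjTuple 1 y = y := by funext i; simp [conjTuple]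
  rw [← darboux_conj_left, ← funext fun x => evalWord_conjTuple w x y,
    darboux_comp (1 : G) (mdifferentiableAt_evalWord w _)
      ((contMDiff_conjTuple_left y 1).mdifferentiableAt (by simp)), h1]
  rfl

/-- The contraction of the surface form with a vector tangent to a conjugation orbit is the
pullback under `ε_R` of a 1-form. -/
theorem surfaceForm_generator (B : InvariantInner E G) (y : Fin (2 * g) → G) (η : E)
    (v : Fin 2 → Fin (2 * g) → E) 
    (hv : v 0 = mfd 𝓘(ℝ, E) (powModel E (2 * g)) (fun x : G => conjTuple x y) 1 η) :
    surfaceForm g B y v =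
      B.bilin η (darboux (powModel E (2 * g)) (relEval g) y (v 1) +
        adjoint E (relEval g y) (darboux (powModel E (2 * g)) (relEval g) y (v 1))) := by
  -- The 1-form is chosen so that its coboundary on `(a, b)` is the contraction of the pullback of
  -- `Ω`; the two are matched term by term after `Ad` is moved across the invariant inner product.
  have hq := surfaceChain_sum_boundary (g := g) fun w =>
    B.bilin η (darboux (powModel E (2 * g)) (evalWord w) y (v 1) +
      adjoint E (evalWord w y) (darboux (powModel E (2 * g)) (evalWord w) y (v 1)))
  have h1 : (evalWord 1 : (Fin (2 * g) → G) → G) = fun _ => 1 := funext evalWord_one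
  simp only [h1, darboux_const, zero_apply, map_zero, add_zero, sub_zero] at hq
  unfold relEval
  rw [surfaceForm_apply, ← hq]
  refine Finsupp.sum_congr fun w _ => congrArg _ ?_
  have hadj : ∀ (x : G) (u : E), B.bilin η (adjoint E x⁻¹ u) = B.bilin (adjoint E x η) u :=
    fun x u => by rw [← B.bilin_adjoint x, adjoint_apply_inv]
  have hadj' : ∀ (x : G) (u : E), B.bilin (adjoint E x⁻¹ η) u = B.bilin η (adjoint E x u) :=
    fun x u => by rw [← B.bilin_adjoint x, adjoint_apply_inv]
  have hmul : (evalWord (w.1 * w.2) : (Fin (2 * g) → G) → G) =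
      fun y => evalWord w.1 y * evalWord w.2 y := funext (evalWord_mul _ _)
  rw [InvariantInner.modelWedge_apply, hmul, darboux_mul (mdifferentiableAt_evalWord _ y)
    (mdifferentiableAt_evalWord _ y), hv]
  simp only [ContinuousLinearMap.comp_apply, darboux_evalWord_generator, add_apply, map_add,
    map_sub, sub_apply, adjoint_mul, adjoint_apply_inv, hadj, hadj']
  rw [B.bilin_comm _ η, B.bilin_comm _ (adjoint E (evalWord w.2 y) η)]
  ring

/-- The surface form is invariant under simultaneous conjugation. -/
theorem surfaceForm_conjTuple (B : InvariantInner E G) (z : G) (y : Fin (2 * g) → G)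
    (v : Fin 2 → Fin (2 * g) → E) :
    surfaceForm g B (conjTuple z y)
        (fun j => mfd (powModel E (2 * g)) (powModel E (2 * g)) (conjTuple z) y (v j)) =
      surfaceForm g B y v := by
  rw [surfaceForm_apply, surfaceForm_apply]
  refine Finsupp.sum_congr fun w _ => congrArg _ ?_
  -- Conjugation by `z` multiplies every `θ_w` by `Ad_z`, and hence every `Ad_w θ_w` as well; the
  -- invariant inner product does not see this factor.
  have hL : ∀ (w : FreeGroup (Fin (2 * g))) (u : Fin (2 * g) → E),
      darboux (powModel E (2 * g)) (evalWord w) (conjTuple z y)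
        (mfd (powModel E (2 * g)) (powModel E (2 * g)) (conjTuple z) y u) =
      adjoint E z (darboux (powModel E (2 * g)) (evalWord w) y u) := fun w u => by
    rw [← ContinuousLinearMap.comp_apply, ← darboux_comp y (mdifferentiableAt_evalWord w _)
      ((contMDiff_conjTuple z y).mdifferentiableAt (by simp)),
      funext fun s => evalWord_conjTuple w z s, darboux_conj z (mdifferentiableAt_evalWord w y)]
    rfl
  simp only [InvariantInner.modelWedge_apply, ContinuousLinearMap.comp_apply, hL,
    evalWord_conjTuple, adjoint_mul, adjoint_inv_apply, B.bilin_adjoint]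

theorem darboux_relEval_eq_zero {y : Fin (2 * g) → G} (v : levelTangent E g y) :
    darboux (powModel E (2 * g)) (relEval g) y (v.1 : Fin (2 * g) → E) = (0 : E) := by
  refine (leftMC_mfderiv (a := relEval g) (mdifferentiableAt_evalWord _ y) _).symm.trans ?_
  exact (congrArg (leftMC E (relEval g y)) v.2).trans (map_zero _)

theorem restrictedForm_eq_zero (B : InvariantInner E G) (y : levelSet g t)
    (v : Fin 2 → levelTangent E g y.1) (hv : v 0 ∈ orbitTangent (E := E) g t y) :
    restrictedForm B y.1 v = 0 := by
  -- That `η` centralizes `t` plays no role here: on `T_y Y_t` the contraction vanishes for every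
  -- `η` in the Lie algebra.
  obtain ⟨η, -, hη⟩ := hv
  refine (surfaceForm_generator B y.1 η (fun j => (v j).1) hη.symm).trans ?_
  rw [darboux_relEval_eq_zero (v 1)]
  simp

/-- The chosen lift differs from any other by orbit directions, which lie in the radical, so the
induced form does not depend on the section. -/
theorem restrictedForm_quotSection (B : InvariantInner E G) (y : levelSet g t)
    (v : Fin 2 → levelTangent E g y.1) :
    restrictedForm B y.1 (fun j => quotSection y (Submodule.Quotient.mk (v j))) =
      restrictedForm B y.1 v :=
  (restrictedForm B y.1).eq_of_sub_mem (orbitTangent (E := E) g t y)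
    (restrictedForm_eq_zero B y)
    fun j => (Submodule.Quotient.eq _).1 (mk_quotSection y (Submodule.Quotient.mk (v j)))

/-- The form induced by the surface form on the relative character variety. -/
def quotSurfaceForm (B : InvariantInner E G) (g : ℕ) (t : G) : QuotTwoForm E g t where
  form _ y _ := (restrictedForm B y.1).compLinearMap (quotSection y)
  compat m y z hy hzy v v' h := by
    refine (restrictedForm_quotSection B (z • y) v').trans
      (Eq.trans ?_ (restrictedForm_quotSection B y v).symm)
    refine Eq.trans ?_ (surfaceForm_conjTuple B (z : G) y.1 fun j => (v j).1)
    exact congrArg (surfaceForm g B (conjTuple (z : G) y.1)) (funext h)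

theorem quotSurfaceForm_isDescentOf (B : InvariantInner E G) :
    (quotSurfaceForm B g t).IsDescentOf (surfaceForm g B) :=
  fun y v => restrictedForm_quotSection B y v

theorem isSmooth_surfaceForm (B : InvariantInner E G) : DiffForm.IsSmooth (surfaceForm g B) :=
  fun y => (contDiffOn_surfacePullback B (isOpen_extChartAt_target y)
    (contMDiffOn_extChartAt_symm_pow y)).contDiffAt (extChartAt_target_mem_nhds y)

theorem extDeriv_surfaceForm_levelTangent (B : InvariantInner E G) (y : Fin (2 * g) → G)
    (v : Fin 3 → levelTangent E g y) :
    DiffForm.extDeriv (surfaceForm g B) y (fun j => (v j).1) = 0 := by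
  have hs := contMDiffOn_extChartAt_symm_pow (E := E) y
  have hmem := mem_extChartAt_target (I := powModel E (2 * g)) y
  have hd : MDifferentiableAt 𝓘(ℝ, Fin (2 * g) → E) (powModel E (2 * g))
      (extChartAt (powModel E (2 * g)) y).symm (extChartAt (powModel E (2 * g)) y y) :=
    (hs.contMDiffAt (extChartAt_target_mem_nhds y)).mdifferentiableAt (by simp)
  refine (extDeriv_surfacePullback B (isOpen_extChartAt_target y) hs hmem
    fun j => (v j).1).trans ?_
  have h0 : ∀ i, darboux 𝓘(ℝ, Fin (2 * g) → E)
      (fun r => relEval g ((extChartAt (powModel E (2 * g)) y).symm r))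
      (extChartAt (powModel E (2 * g)) y y) (v i).1 = (0 : E) := fun i => by
    have hc := darboux_comp (a := relEval g) _ (mdifferentiableAt_evalWord (E := E) _ _) hd
    rw [mfd_extChartAt_symm_self hd, extChartAt_to_inv, ContinuousLinearMap.comp_id] at hc
    exact (DFunLike.congr_fun hc (v i).1).trans (darboux_relEval_eq_zero (v i))
  rw [funext h0, B.triple_zero, neg_zero]

theorem restrictsToClosed_surfaceForm (B : InvariantInner E G) (t : G) :
    DiffForm.RestrictsToClosed (surfaceForm g B) (levelSet g t) := by
  intro n U f hf
  refine ⟨contDiffOn_surfacePullback B hf.1 hf.2.1, fun r hr => ContinuousAlternatingMap.ext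
    fun v => (extDeriv_surfacePullback B hf.1 hf.2.1 hr v).trans ?_⟩
  -- Along a plot `ε_R` is locally constant, so its logarithmic derivative, and with it the cubic
  -- form, is zero.
  rw [darboux_congr (relEval_plot_eventuallyEq hf hr), darboux_const]
  simp [B.triple_zero]

theorem mfderiv_plot_mem_levelTangent
    (hf : DiffForm.IsPlotInto (powModel E (2 * g)) (levelSet g t) U f)
    {r : EuclideanSpace ℝ (Fin n)} (hr : r ∈ U) (a : EuclideanSpace ℝ (Fin n)) :
    mfderiv 𝓘(ℝ, EuclideanSpace ℝ (Fin n)) (powModel E (2 * g)) f r a ∈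
      levelTangent E g (f r) := by
  have h := mfd_comp (I₃ := 𝓘(ℝ, E)) r (mdifferentiableAt_evalWord (surfaceRel g) (f r))
    ((hf.2.1.contMDiffAt (hf.1.mem_nhds hr)).mdifferentiableAt (by simp))
  have h0 := mfd_congr (I₁ := 𝓘(ℝ, EuclideanSpace ℝ (Fin n))) (I₂ := 𝓘(ℝ, E))
    (relEval_plot_eventuallyEq hf hr)
  rw [mfd_const] at h0
  exact (DFunLike.congr_fun (h.symm.trans h0) a)

theorem quotSurfaceForm_isSmoothClosed (B : InvariantInner E G) :
    (quotSurfaceForm B g t).IsSmoothClosed := by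
  intro n U f hf
  refine ⟨surfacePullback B f, fun r hr a => ?_, restrictsToClosed_surfaceForm B t n U f hf⟩
  refine ⟨fun j => ⟨_, mfderiv_plot_mem_levelTangent hf hr (a j)⟩, fun j => rfl, ?_⟩
  exact (quotSurfaceForm_isDescentOf B ⟨f r, hf.2.2 hr⟩ fun j =>
    ⟨_, mfderiv_plot_mem_levelTangent hf hr (a j)⟩).symm

end Descent

end

theorem propositionp3
    {E : Type*} [NormedAddCommGroup E] [NormedSpace ℝ E] [FiniteDimensional ℝ E]
    {G : Type*} [TopologicalSpace G] [ChartedSpace E G] [Group G] [LieGroup 𝓘(ℝ, E) ∞ G]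
    [T2Space G] [CompactSpace G] [ConnectedSpace G]
    (B : InvariantInner E G) (g : ℕ) (t : G) :
    -- `ω` is a smooth 2-form on `Y = G^{2g}`
    DiffForm.IsSmooth (surfaceForm g B) ∧
    -- `dω` vanishes on the Zariski tangent spaces of `Y_t`
    (∀ y ∈ levelSet g t, ∀ v : Fin 3 → levelTangent E g y,
      DiffForm.extDeriv (surfaceForm g B) y (fun j => (v j).1) = 0) ∧
    -- `ω` restricts to a closed form on `Y_t`
    DiffForm.RestrictsToClosed (surfaceForm g B) (levelSet g t) ∧
    -- `ω` descends to a unique form on `M_t = Y_t / Z_t`, and this form is closed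
    ∃ β : QuotTwoForm E g t, β.IsDescentOf (surfaceForm g B) ∧ β.IsSmoothClosed ∧
      ∀ β' : QuotTwoForm E g t, β'.IsDescentOf (surfaceForm g B) → β' = β := by
  exact ⟨isSmooth_surfaceForm B, fun y _ v => extDeriv_surfaceForm_levelTangent B y v,
    restrictsToClosed_surfaceForm B t, quotSurfaceForm B g t, quotSurfaceForm_isDescentOf B,
    quotSurfaceForm_isSmoothClosed B,
    fun _ h => (quotSurfaceForm_isDescentOf B).unique h⟩
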